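/- Let $N\ge 2$ be an integer, let $\mathbb T=\{z\in\mathbb C:|z|=1\}$ and let $\mu$ be normalized Haar measure on $\mathbb T$. For $m_0\in C(\mathbb T)$ let $R_{m_0}$ be the Ruelle operator on $C(\mathbb T)$, $$(R_{m_0}f)(z)=\frac1N\sum_{w\in\mathbb T,\ w^N=z}|m_0(w)|^2f(w).$$ Consider the following conditions on a filter $m_0$: (1) $m_0$ is Lipschitz on $\mathbb T$; (2) $m_0$ has only finitely many zeros; (3) $R_{m_0}(1)=1$. An $(m_0,N)$-cycle is a finite family $z_1,\dots,z_p\in\mathbb T$ ($p\ge1$) with $z_i^N=z_{i+1}$ for $i<p$, $z_p^N=z_1$, and $|m_0(z_i)|^2=N$ for all $i$. A probability measure $\nu$ on $\mathbb T$ is invariant for $R_{m_0}$ if $\int R_{m_0}f\,d\nu=\int f\,d\nu$ for all $f\in C(\mathbb T)$. The wavelet representation associated to $(m_0,1)$ is the system $(H,U,\pi,\varphi)$, determined up to unitary equivalence, consisting of a complex Hilbert space $H$, a unitary operator $U$ on $H$, a unital $*$-representation $\pi$ of $L^\infty(\mathbb T,\mu)$ on $H$, and a vector $\varphi\in H$ such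 that $U\pi(f)U^{-1}=\pi(f(z^N))$ for all $f\in L^\infty(\mathbb T)$, $U\varphi=\pi(m_0)\varphi$, $\langle\varphi\mid\pi(f)\varphi\rangle=\int_{\mathbb T}f\,d\mu$ for all $f\in L^\infty(\mathbb T)$, and the vectors $U^{-m}\pi(f)\varphi$ ($m\in\mathbb Z$, $f\in L^\infty(\mathbb T)$) span a dense subspace of $H$. The classical wavelet representation on $L^2(\mathbb R)$ is given by $(Ug)(x)=N^{-1/2}g(x/N)$ and $\pi(f)=f(T)$, where $(Tg)(x)=g(x-1)$; that is, $\pi(f)$ is multiplication by $f(e^{-2\pi i\xi})$ after the Fourier transform. Two such representations $(H,U,\pi)$ and $(H',U',\pi')$ are disjoint if the only bounded operator $W:H\to H'$ with $WU=U'W$ and $W\pi(f)=\pi'(f)W$ for all $f\in L^\infty(\mathbb T)$ is $W=0$. **Theorem.** Let $m_0,m_0'$ be two filters satisfying (1), (2), (3), and suppose that $1$ is a simple eigenvalue of $R_{m_0}$ and of $R_{m_0'}$ on $C(\mathbb T)$. Let $\nu$ and $\nu'$ be the invariant probability measures for $R_{m_0}$ and $R_{m_0'}$ respectively, and let $(H,U,\pi,\varphi)$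 and $(H',U',\pi',\varphi')$ be the wavelet representations associated to $(m_0,1)$ and $(m_0',1)$ respectively. If $\nu\ne\nu'$, then the two wavelet representations are disjoint. **Corollary.** Let $m_0$ be a filter that satisfies (1), (2), (3) and suppose there are no $(m_0,N)$-cycles. Then the wavelet representation associated to $(m_0,1)$ is disjoint from the classical wavelet representation on $L^2(\mathbb R)$. -/

import Mathlib

open MeasureTheory ENNReal

universe u v

namespace WaveletRep

noncomputable section

/-! ### The torus and its Haar measure -/

instance instMeasurableSpaceCircle : MeasurableSpace Circle := borel Circle

instance instBorelSpaceCircle : BorelSpace Circle := ⟨rfl⟩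

/-- Normalized Haar measure on the torus `{z : |z| = 1}`. -/
def haar : Measure Circle := Measure.haarMeasure ⊤

instance instIsHaarMeasure : haar.IsHaarMeasure := by
  unfold haar; infer_instance

instance instIsProbabilityMeasure : IsProbabilityMeasure haar :=
  ⟨by simpa [haar] using Measure.haarMeasure_self (K₀ := (⊤ : TopologicalSpace.PositiveCompacts Circle))⟩

theorem measurePreserving_pow (N : ℕ) [NeZero N] :
    MeasurePreserving (fun z : Circle => z ^ N) haar haar :=
  MonoidHom.measurePreserving (f := powMonoidHom (α := Circle) N) (continuous_pow N)
    (Circle.isQuotientCoveringMap_npow N).surjective rfl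

/-! ### The Ruelle operator -/

theorem finite_fibre (N : ℕ) [NeZero N] (z : Circle) : {w : Circle | w ^ N = z}.Finite := by
  refine Set.Finite.of_finite_image (f := fun w : Circle => (w : ℂ))
    ((Polynomial.nthRoots N (z : ℂ)).toFinset.finite_toSet.subset ?_) Subtype.val_injective.injOn
  rintro _ ⟨w, rfl, rfl⟩
  simp [Polynomial.mem_nthRoots (Nat.pos_of_ne_zero (NeZero.ne N))]

theorem continuous_fibreSum (N : ℕ) [NeZero N] (g : C(Circle, ℂ)) :
    Continuous fun z : Circle => ∑ᶠ w ∈ {w : Circle | w ^ N = z}, g w := by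
  have hq := (Circle.isQuotientCoveringMap_npow N).toIsQuotientMap
  refine hq.continuous_iff.2 ?_
  have : ((fun z : Circle => ∑ᶠ w ∈ {w : Circle | w ^ N = z}, g w) ∘ fun z : Circle => z ^ N) =
      fun v => ∑ ζ ∈ (finite_fibre N 1).toFinset, g (ζ * v) := by
    funext v
    rw [← finsum_mem_eq_finite_toFinset_sum _ (finite_fibre N 1)]
    symm
    refine finsum_mem_eq_of_bijOn (t := {w : Circle | w ^ N = v ^ N})
      (fun ζ => ζ * v) ⟨?_, ?_, ?_⟩ fun _ _ => rfl
    · intro ζ hζ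
      have : ζ ^ N = 1 := hζ
      simp [mul_pow, this]
    · exact fun a _ b _ h => mul_right_cancel h
    · intro w hw
      have : w ^ N = v ^ N := hw
      exact ⟨w / v, by simp [div_pow, this], by simp⟩
  rw [this]
  fun_prop

/-- The Ruelle operator `(R f)(z) = (1/N) ∑_{w^N = z} |m₀(w)|² f(w)` on `C(𝕋)`. -/
def ruelle (N : ℕ) [NeZero N] (m₀ : C(Circle, ℂ)) : Module.End ℂ C(Circle, ℂ) where
  toFun f :=
    { toFun := fun z => (1 / (N : ℂ)) * ∑ᶠ w ∈ {w : Circle | w ^ N = z}, (‖m₀ w‖ : ℂ) ^ 2 * f w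
      continuous_toFun := continuous_const.mul
        (continuous_fibreSum N ⟨fun w => (‖m₀ w‖ : ℂ) ^ 2 * f w, by fun_prop⟩) }
  map_add' f g := by
    ext z
    simp only [ContinuousMap.coe_mk, ContinuousMap.add_apply, ← mul_add]
    rw [← finsum_mem_add_distrib (finite_fibre N z)]
    congr 1
    refine finsum_mem_congr rfl fun w _ => ?_
    ring
  map_smul' c f := by
    ext z
    simp only [ContinuousMap.coe_mk, ContinuousMap.smul_apply, smul_eq_mul, RingHom.id_apply]
    rw [mul_left_comm c, mul_finsum_mem _ c]
    congr 1
    refine finsum_mem_congr rfl fun w _ => ?_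
    ring

/-- The three standing conditions on a filter: it is Lipschitz, it has finitely many zeros, and
`R_{m₀} 1 = 1`. -/
structure IsFilter (N : ℕ) [NeZero N] (m₀ : C(Circle, ℂ)) : Prop where
  lipschitz : ∃ K, LipschitzWith K m₀
  finite_zeros : {z : Circle | m₀ z = 0}.Finite
  ruelle_one : ruelle N m₀ 1 = 1

/-- `1` is a simple eigenvalue of `R_{m₀}` on `C(𝕋)`. -/
def OneIsSimple (N : ℕ) [NeZero N] (m₀ : C(Circle, ℂ)) : Prop :=
  Module.finrank ℂ (Module.End.eigenspace (ruelle N m₀) 1) = 1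

/-- `ν` is invariant for `R_{m₀}`: `ν (R_{m₀} f) = ν f` for all continuous `f`. -/
def IsInvariant (N : ℕ) [NeZero N] (m₀ : C(Circle, ℂ)) (ν : Measure Circle) : Prop :=
  ∀ f : C(Circle, ℂ), ∫ z, ruelle N m₀ f z ∂ν = ∫ z, f z ∂ν

/-- `z₀, …, z_p` is an `(m₀, N)`-cycle; the indices are read cyclically, modulo `p + 1`. -/
def IsCycle (N : ℕ) (m₀ : C(Circle, ℂ)) {p : ℕ} (z : Fin (p + 1) → Circle) : Prop :=
  ∀ i, z i ^ N = z (i + 1) ∧ ‖m₀ (z i)‖ ^ 2 = N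

/-! ### Representations of `L^∞(𝕋)` together with a scaling unitary -/

/-- The algebra `L^∞(𝕋)`. -/
abbrev Linfty : Type := Lp ℂ ∞ haar

theorem memLp_top_comp {α β : Type*} [MeasurableSpace α] [MeasurableSpace β] {μ : Measure α}
    {ν : Measure β} {e : α → β} (he : Measure.QuasiMeasurePreserving e μ ν) (f : Lp ℂ ∞ ν) :
    MemLp (f ∘ e) ∞ μ := by
  refine memLp_top_of_bound ((Lp.aestronglyMeasurable f).comp_quasiMeasurePreserving he)
    ‖f‖ (he.ae (p := fun x => ‖f x‖ ≤ ‖f‖) ?_)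
  have h := ae_le_eLpNormEssSup (f := (f : β → ℂ)) (μ := ν)
  filter_upwards [h] with x hx
  rw [Lp.norm_def, eLpNorm_exponent_top, ← toReal_enorm]
  exact ENNReal.toReal_mono (by simpa using Lp.eLpNorm_ne_top f) hx

/-- Composition `f ↦ f ∘ e` of an `L^∞` function with a quasi measure preserving map. -/
def linftyComp {α β : Type*} [MeasurableSpace α] [MeasurableSpace β] {μ : Measure α}
    {ν : Measure β} {e : α → β} (he : Measure.QuasiMeasurePreserving e μ ν) (f : Lp ℂ ∞ ν) :
    Lp ℂ ∞ μ :=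
  (memLp_top_comp he f).toLp (f ∘ e)

theorem coeFn_linftyComp {α β : Type*} [MeasurableSpace α] [MeasurableSpace β] {μ : Measure α}
    {ν : Measure β} {e : α → β} (he : Measure.QuasiMeasurePreserving e μ ν) (f : Lp ℂ ∞ ν) :
    linftyComp he f =ᵐ[μ] f ∘ e :=
  MemLp.coeFn_toLp _

/-- `f(z) ↦ f(z^N)` on `L^∞(𝕋)`. -/
def compPow (N : ℕ) [NeZero N] (f : Linfty) : Linfty :=
  linftyComp (measurePreserving_pow N).quasiMeasurePreserving f

/-- A unitary `U` on a Hilbert space `H` with a unital `*`-representation `π` of `L^∞(𝕋)` such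
that `U π(f) U⁻¹ = π(f(z^N))`. In `map_mul`, `f • g` is the pointwise product. -/
structure ScalingRep (N : ℕ) [NeZero N] (H : Type*) [NormedAddCommGroup H]
    [InnerProductSpace ℂ H] [CompleteSpace H] where
  U : H ≃ₗᵢ[ℂ] H
  π : Linfty →ₗ[ℂ] (H →L[ℂ] H)
  map_one : π (Lp.const ∞ haar 1) = 1
  map_mul : ∀ f g : Linfty, π (f • g : Linfty) = π f * π g
  map_star : ∀ f : Linfty, π (star f) = ContinuousLinearMap.adjoint (π f)
  covariance : ∀ (f : Linfty) (x : H), U (π f (U.symm x)) = π (compPow N f) x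

/-- `(H, U, π, φ)` is the wavelet representation associated to `(m₀, h)`: the scaling identity
`U φ = π(m₀) φ` holds, `⟨φ, π(f) φ⟩ = ∫ f h dμ` for all `f ∈ L^∞(𝕋)`, and the vectors
`U^{-m} π(f) φ` span a dense subspace. It is determined by these properties up to unitary
equivalence. -/
structure IsWaveletRep {N : ℕ} [NeZero N] {H : Type*} [NormedAddCommGroup H]
    [InnerProductSpace ℂ H] [CompleteSpace H] (ρ : ScalingRep N H) (φ : H)
    (m₀ : C(Circle, ℂ)) (h : Circle → ℂ) : Prop where
  scaling : ρ.U φ = ρ.π (ContinuousMap.toLp ∞ haar ℂ m₀) φ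
  correlation : ∀ f : Linfty, inner ℂ φ (ρ.π f φ) = ∫ z, f z * h z ∂haar
  cyclic : Dense (Submodule.span ℂ
    {x : H | ∃ (m : ℤ) (f : Linfty), x = (ρ.U ^ (-m)) (ρ.π f φ)} : Set H)

/-- Two representations are disjoint if the only bounded operator that intertwines them is `0`
(equivalently, no nonzero subrepresentation of one is unitarily equivalent to a subrepresentation
of the other). -/
def DisjointReps {N : ℕ} [NeZero N] {H H' : Type*} [NormedAddCommGroup H]
    [InnerProductSpace ℂ H] [CompleteSpace H] [NormedAddCommGroup H']
    [InnerProductSpace ℂ H'] [CompleteSpace H'] (ρ : ScalingRep N H) (ρ' : ScalingRep N H') :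
    Prop :=
  ∀ W : H →L[ℂ] H', (∀ x, W (ρ.U x) = ρ'.U (W x)) →
    (∀ (f : Linfty) (x : H), W (ρ.π f x) = ρ'.π f (W x)) → W = 0

/-! ### The classical representation on `L²(ℝ)` -/

/-- The Hilbert space `L²(ℝ)`. -/
abbrev L2R : Type := Lp ℂ 2 (volume : Measure ℝ)

/-- The map `ξ ↦ e^{-2πiξ}` from `ℝ` to the torus. -/
def expMap (ξ : ℝ) : Circle := Circle.exp (-(2 * Real.pi * ξ))

theorem continuous_expMap : Continuous expMap := by
  unfold expMap; fun_prop

theorem measurePreserving_toCircle :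
    MeasurePreserving (AddCircle.toCircle : UnitAddCircle → Circle) volume haar := by
  have hc : Continuous (AddCircle.toCircle : UnitAddCircle → Circle) := AddCircle.continuous_toCircle
  refine ⟨hc.measurable, ?_⟩
  have hinv : (Measure.map (AddCircle.toCircle : UnitAddCircle → Circle)
      volume).IsMulLeftInvariant := by
    refine ⟨fun w => ?_⟩
    obtain ⟨x, rfl⟩ : ∃ x : UnitAddCircle, AddCircle.toCircle x = w := by
      obtain ⟨x, hx⟩ := (AddCircle.homeomorphCircle (one_ne_zero (α := ℝ))).surjective w
      exact ⟨x, by rw [← AddCircle.homeomorphCircle_apply one_ne_zero, hx]⟩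
    rw [Measure.map_map (measurable_const_mul _) hc.measurable]
    have : ((fun z => AddCircle.toCircle x * z) ∘ AddCircle.toCircle) =
        (AddCircle.toCircle : UnitAddCircle → Circle) ∘ fun y => x + y := by
      funext y
      simp [AddCircle.toCircle_add]
    rw [this, ← Measure.map_map hc.measurable (measurable_const_add _), map_add_left_eq_self]
  have : IsFiniteMeasure (Measure.map (AddCircle.toCircle : UnitAddCircle → Circle) volume) :=
    Measure.isFiniteMeasure_map _ _
  rw [Measure.haarMeasure_unique (Measure.map (AddCircle.toCircle : UnitAddCircle → Circle) volume)
    ⊤, Measure.map_apply hc.measurable (by simp)]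
  simp [haar]

theorem quasiMeasurePreserving_expMap :
    Measure.QuasiMeasurePreserving expMap volume haar := by
  refine ⟨continuous_expMap.measurable, Measure.AbsolutelyContinuous.mk fun s hs h0 => ?_⟩
  rw [Measure.map_apply continuous_expMap.measurable hs]
  have h1 : haar (Inv.inv ⁻¹' s) = 0 := by rw [Measure.measure_preimage_inv, h0]
  have h2 : volume ((fun x : ℝ => AddCircle.toCircle (x : UnitAddCircle)) ⁻¹' (Inv.inv ⁻¹' s)) = 0 := by
    set A := (fun x : ℝ => AddCircle.toCircle (x : UnitAddCircle)) ⁻¹' (Inv.inv ⁻¹' s) with hA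
    have key : ∀ n : ℤ, volume (A ∩ Set.Ioc (n : ℝ) (n + 1)) = 0 := by
      intro n
      have hmp := measurePreserving_toCircle.comp (UnitAddCircle.measurePreserving_mk (n : ℝ))
      have := hmp.measure_preimage (measurable_inv hs).nullMeasurableSet
      rw [h1] at this
      rwa [Measure.restrict_apply' measurableSet_Ioc] at this
    have : A = ⋃ n : ℤ, A ∩ Set.Ioc (n : ℝ) (n + 1) := by
      rw [← Set.inter_iUnion, iUnion_Ioc_intCast, Set.inter_univ]
    rw [this]
    exact measure_iUnion_null key
  convert h2 using 2
  ext x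
  simp [expMap, AddCircle.toCircle_apply_mk]

/-- Multiplication of `g ∈ L²(ℝ)` by `f(e^{-2πiξ})`, for `f ∈ L^∞(𝕋)`. -/
def mulOp (f : Linfty) : L2R →L[ℂ] L2R :=
  LinearMap.mkContinuous
    { toFun := fun g => (linftyComp quasiMeasurePreserving_expMap f • g : L2R)
      map_add' := fun _ _ => Lp.add_smul _ _ _
      map_smul' := fun c _ => (Lp.smul_comm c _ _).symm }
    ‖linftyComp quasiMeasurePreserving_expMap f‖ fun _ => Lp.norm_smul_le _ _

theorem coeFn_mulOp (f : Linfty) (g : L2R) :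
    mulOp f g =ᵐ[volume] fun ξ => f (expMap ξ) * g ξ := by
  have h1 : ((linftyComp quasiMeasurePreserving_expMap f • g : L2R) : ℝ → ℂ) =ᵐ[volume]
      (linftyComp quasiMeasurePreserving_expMap f : ℝ → ℂ) • (g : ℝ → ℂ) := Lp.coeFn_lpSMul _ _
  change ((linftyComp quasiMeasurePreserving_expMap f • g : L2R) : ℝ → ℂ) =ᵐ[volume] _
  filter_upwards [h1, coeFn_linftyComp quasiMeasurePreserving_expMap f] with x hx hx'
  rw [hx, Pi.smul_apply', hx', Function.comp_apply, smul_eq_mul]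

theorem quasiMeasurePreserving_mul {a : ℝ} (ha : 0 < a) :
    Measure.QuasiMeasurePreserving (fun x : ℝ => a * x) volume volume := by
  refine ⟨measurable_const_mul a, ?_⟩
  rw [Real.map_volume_mul_left ha.ne']
  exact Measure.smul_absolutelyContinuous

theorem eLpNorm_dilate {a : ℝ} (ha : 0 < a) (f : L2R) :
    eLpNorm (fun x => (√a : ℂ) * f (a * x)) 2 volume = eLpNorm f 2 volume := by
  have h := eLpNorm_map_measure (p := 2) (μ := volume) (f := fun x : ℝ => a * x) (g := f)
    (by rw [Real.map_volume_mul_left ha.ne']; exact (Lp.aestronglyMeasurable f).smul_measure _)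
    (measurable_const_mul a).aemeasurable
  have h' : ENNReal.ofReal |a⁻¹| = ((Real.toNNReal a⁻¹ : NNReal) : ℝ≥0∞) := by
    rw [abs_of_pos (inv_pos.2 ha)]; rfl
  rw [Real.map_volume_mul_left ha.ne', h'] at h
  erw [eLpNorm_smul_measure_of_ne_top (p := 2) (by simp) (f : ℝ → ℂ) (Real.toNNReal a⁻¹)] at h
  have h2 : (fun x => (√a : ℂ) * f (a * x)) = (√a : ℂ) • ((f : ℝ → ℂ) ∘ fun x => a * x) := rfl
  have h3 : ‖(√a : ℂ)‖ₑ = ((NNReal.sqrt (Real.toNNReal a) : NNReal) : ℝ≥0∞) := by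
    rw [enorm_eq_nnnorm]
    congr 1
    ext
    simp [abs_of_nonneg (Real.sqrt_nonneg a), max_eq_left ha.le]
  rw [h2, eLpNorm_const_smul, ← h, h3, smul_eq_mul, ← mul_assoc]
  have h4 : NNReal.sqrt (Real.toNNReal a) * Real.toNNReal a⁻¹ ^ (1 / (2 : ℝ≥0∞)).toReal = 1 := by
    have : (1 / (2 : ℝ≥0∞)).toReal = 1 / 2 := by simp
    rw [this, ← NNReal.sqrt_eq_rpow, ← NNReal.sqrt_mul, ← Real.toNNReal_mul ha.le,
      mul_inv_cancel₀ ha.ne']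
    simp
  rw [← ENNReal.coe_rpow_of_nonneg _ (by simp), ← ENNReal.coe_mul, h4, ENNReal.coe_one, one_mul]

/-- The dilation `f ↦ a^{1/2} f(a x)` on `L²(ℝ)`. -/
def dilate {a : ℝ} (ha : 0 < a) (f : L2R) : L2R :=
  MemLp.toLp (fun x => (√a : ℂ) * f (a * x))
    ⟨((Lp.aestronglyMeasurable f).comp_quasiMeasurePreserving
      (quasiMeasurePreserving_mul ha)).const_mul _, by
      rw [eLpNorm_dilate ha]; exact Lp.eLpNorm_lt_top f⟩

theorem coeFn_dilate {a : ℝ} (ha : 0 < a) (f : L2R) :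
    dilate ha f =ᵐ[volume] fun x => (√a : ℂ) * f (a * x) :=
  MemLp.coeFn_toLp _

theorem dilate_dilate {a b : ℝ} (ha : 0 < a) (hb : 0 < b) (hab : a * b = 1) (f : L2R) :
    dilate ha (dilate hb f) = f := by
  refine Lp.ext ?_
  have hs : (√a : ℂ) * (√b : ℂ) = 1 := by
    rw [← Complex.ofReal_mul, ← Real.sqrt_mul ha.le, hab]; simp
  filter_upwards [coeFn_dilate ha (dilate hb f),
    (quasiMeasurePreserving_mul ha).ae (coeFn_dilate hb f)] with x hx hx'
  rw [hx, hx', ← mul_assoc, hs, one_mul, ← mul_assoc, mul_comm b a, hab, one_mul]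

/-- Dilation as a unitary operator on `L²(ℝ)`. -/
def dilateEquiv {a : ℝ} (ha : 0 < a) : L2R ≃ₗᵢ[ℂ] L2R where
  toFun := dilate ha
  invFun := dilate (inv_pos.2 ha)
  left_inv := dilate_dilate _ _ (inv_mul_cancel₀ ha.ne')
  right_inv := dilate_dilate _ _ (mul_inv_cancel₀ ha.ne')
  map_add' f g := by
    refine Lp.ext ?_
    filter_upwards [coeFn_dilate ha (f + g), Lp.coeFn_add (dilate ha f) (dilate ha g),
      coeFn_dilate ha f, coeFn_dilate ha g,
      (quasiMeasurePreserving_mul ha).ae (Lp.coeFn_add f g)] with x h1 h2 h3 h4 h5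
    rw [h1, h2, Pi.add_apply, h3, h4, h5, Pi.add_apply, mul_add]
  map_smul' c f := by
    refine Lp.ext ?_
    filter_upwards [coeFn_dilate ha (c • f), Lp.coeFn_smul c (dilate ha f),
      coeFn_dilate ha f, (quasiMeasurePreserving_mul ha).ae (Lp.coeFn_smul c f)] with x h1 h2 h3 h4
    rw [h1, RingHom.id_apply, h2, Pi.smul_apply, h3, h4, Pi.smul_apply, smul_eq_mul, smul_eq_mul,
      mul_left_comm]
  norm_map' f := by
    change ‖dilate ha f‖ = ‖f‖
    rw [Lp.norm_def, Lp.norm_def, eLpNorm_congr_ae (coeFn_dilate ha f), eLpNorm_dilate ha]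

/-- The Fourier transform on `L²(ℝ)`, `(𝓕 g)(ξ) = ∫ e^{-2πiξx} g(x) dx`. -/
abbrev fourierL2 : L2R ≃ₗᵢ[ℂ] L2R := Lp.fourierTransformₗᵢ ℝ ℂ

theorem fourierL2_dilate {a : ℝ} (ha : 0 < a) (g : L2R) :
    fourierL2 (dilateEquiv ha g) = (dilateEquiv ha).symm (fourierL2 g) := by
  refine DenseRange.induction_on (p := fun g : L2R =>
      fourierL2 (dilateEquiv ha g) = (dilateEquiv ha).symm (fourierL2 g))
    (SchwartzMap.denseRange_toLpCLM (E := ℝ) (F := ℂ) (μ := volume) (p := 2)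
      ENNReal.ofNat_ne_top) g ?_ ?_
  · exact isClosed_eq (by fun_prop) (by fun_prop)
  intro s
  let e : ℝ ≃L[ℝ] ℝ := ContinuousLinearEquiv.unitsEquivAut ℝ (Units.mk0 a ha.ne')
  have he : ∀ x, e x = x * a := fun x => rfl
  let s' : SchwartzMap ℝ ℂ := (√a : ℂ) • SchwartzMap.compCLMOfContinuousLinearEquiv ℂ e s
  have hs' : ∀ x, s' x = (√a : ℂ) * s (a * x) := fun x => by
    simp [s', he, mul_comm]
  have h1 : dilateEquiv ha (s.toLp 2) = s'.toLp 2 := by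
    refine Lp.ext ?_
    filter_upwards [coeFn_dilate ha (s.toLp 2), s'.coeFn_toLp 2 volume,
      (quasiMeasurePreserving_mul ha).ae (s.coeFn_toLp 2 volume)] with x h1 h2 h3
    rw [h2, hs', ← h3, ← h1]
    rfl
  change fourierL2 (dilateEquiv ha (s.toLp 2)) = (dilateEquiv ha).symm (fourierL2 (s.toLp 2))
  rw [h1]
  change FourierTransform.fourier (s'.toLp 2) = (dilateEquiv ha).symm (FourierTransform.fourier (s.toLp 2))
  rw [SchwartzMap.toLp_fourier_eq, SchwartzMap.toLp_fourier_eq]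
  refine Lp.ext ?_
  filter_upwards [coeFn_dilate (inv_pos.2 ha) ((FourierTransform.fourier s).toLp 2),
    (FourierTransform.fourier s').coeFn_toLp 2 volume,
    (quasiMeasurePreserving_mul (inv_pos.2 ha)).ae
      ((FourierTransform.fourier s).coeFn_toLp 2 volume)] with x h1 h2 h3
  have h4 : (dilateEquiv ha).symm ((FourierTransform.fourier s).toLp 2) =
    dilate (inv_pos.2 ha) ((FourierTransform.fourier s).toLp 2) := rfl
  rw [h2, h4, h1, h3, SchwartzMap.fourier_coe, SchwartzMap.fourier_coe, Real.fourier_eq',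
    Real.fourier_eq']
  have h5 := Measure.integral_comp_mul_left
    (fun v : ℝ => Complex.exp (((-2 * Real.pi * inner ℝ v (a⁻¹ * x) : ℝ) : ℂ) * Complex.I) • s v) a
  have h6 : (√a : ℂ) * ((|a⁻¹| : ℝ) : ℂ) = (√a⁻¹ : ℝ) := by
    rw [← Complex.ofReal_mul, abs_of_pos (inv_pos.2 ha), Real.sqrt_inv]
    congr 1
    have := Real.mul_self_sqrt ha.le
    have h0 : √a ≠ 0 := (Real.sqrt_pos.2 ha).ne'
    field_simp
    nlinarith
  rw [Complex.real_smul] at h5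
  rw [← h6, mul_assoc, ← h5, ← integral_const_mul]
  refine integral_congr_ae (Filter.Eventually.of_forall fun v => ?_)
  simp only [hs', smul_eq_mul, inner, RCLike.re_to_real]
  have : a⁻¹ * x * (a * v) = x * v := by field_simp
  simp [this]
  ring

/-- `π(f) = f(T)` on `L²(ℝ)`, where `T` is translation by `1`: in the Fourier domain `T` is
multiplication by `e^{-2πiξ}`, so that `π(f)` is multiplication by `f(e^{-2πiξ})`. -/
def classicalπ (f : Linfty) : L2R →L[ℂ] L2R :=
  (fourierL2.symm.toContinuousLinearEquiv : L2R →L[ℂ] L2R) ∘L mulOp f ∘L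
    (fourierL2.toContinuousLinearEquiv : L2R →L[ℂ] L2R)

theorem fourierL2_classicalπ (f : Linfty) (x : L2R) :
    fourierL2 (classicalπ f x) = mulOp f (fourierL2 x) :=
  fourierL2.apply_symm_apply _

/-- The classical wavelet representation on `L²(ℝ)`: `(U g)(x) = N^{-1/2} g(x/N)`, and
`π(f) = f(T)` with `(T g)(x) = g(x - 1)`. -/
def classicalRep (N : ℕ) [NeZero N] : ScalingRep N L2R where
  U := dilateEquiv (a := (N : ℝ)⁻¹) (inv_pos.2 (Nat.cast_pos.2 (Nat.pos_of_ne_zero (NeZero.ne N))))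
  π :=
    { toFun := classicalπ
      map_add' := fun f g => by
        refine ContinuousLinearMap.ext fun x => fourierL2.injective (Lp.ext ?_)
        simp only [add_apply, map_add, fourierL2_classicalπ]
        filter_upwards [coeFn_mulOp (f + g) (fourierL2 x), coeFn_mulOp f (fourierL2 x),
          coeFn_mulOp g (fourierL2 x), Lp.coeFn_add (mulOp f (fourierL2 x))
            (mulOp g (fourierL2 x)),
          quasiMeasurePreserving_expMap.ae (Lp.coeFn_add f g)] with ξ h1 h2 h3 h4 h5
        rw [h1, h4, Pi.add_apply, h2, h3, h5, Pi.add_apply, add_mul]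
      map_smul' := fun c f => by
        refine ContinuousLinearMap.ext fun x => fourierL2.injective (Lp.ext ?_)
        simp only [smul_apply, map_smul, fourierL2_classicalπ,
          RingHom.id_apply]
        filter_upwards [coeFn_mulOp (c • f) (fourierL2 x), coeFn_mulOp f (fourierL2 x),
          Lp.coeFn_smul c (mulOp f (fourierL2 x)),
          quasiMeasurePreserving_expMap.ae (Lp.coeFn_smul c f)] with ξ h1 h2 h3 h4
        rw [h1, h3, Pi.smul_apply, h2, h4, Pi.smul_apply, smul_eq_mul, smul_eq_mul, mul_assoc] }
  map_one := by
    refine ContinuousLinearMap.ext fun x => fourierL2.injective (Lp.ext ?_)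
    change (fourierL2 (classicalπ (Lp.const ∞ haar 1) x) : ℝ → ℂ) =ᵐ[volume] fourierL2 x
    rw [fourierL2_classicalπ]
    filter_upwards [coeFn_mulOp (Lp.const ∞ haar 1) (fourierL2 x),
      quasiMeasurePreserving_expMap.ae (Lp.coeFn_const (p := ∞) (μ := haar) (1 : ℂ))] with ξ h1 h2
    rw [h1, h2, Function.const_apply, one_mul]
  map_mul f g := by
    refine ContinuousLinearMap.ext fun x => fourierL2.injective (Lp.ext ?_)
    change (fourierL2 (classicalπ (f • g : Linfty) x) : ℝ → ℂ) =ᵐ[volume]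
      fourierL2 (classicalπ f (classicalπ g x))
    simp only [fourierL2_classicalπ]
    filter_upwards [coeFn_mulOp (f • g : Linfty) (fourierL2 x),
      coeFn_mulOp f (mulOp g (fourierL2 x)), coeFn_mulOp g (fourierL2 x),
      quasiMeasurePreserving_expMap.ae (Lp.coeFn_lpSMul (r := ∞) f g)] with ξ h1 h2 h3 h4
    rw [h1, h2, h3, h4, Pi.smul_apply', smul_eq_mul, mul_assoc]
  map_star f := by
    refine (ContinuousLinearMap.eq_adjoint_iff _ _).2 fun x y => ?_
    change inner ℂ (classicalπ (star f) x) y = inner ℂ x (classicalπ f y)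
    rw [← fourierL2.inner_map_map, ← fourierL2.inner_map_map x, fourierL2_classicalπ,
      fourierL2_classicalπ, L2.inner_def, L2.inner_def]
    refine integral_congr_ae ?_
    filter_upwards [coeFn_mulOp (star f) (fourierL2 x), coeFn_mulOp f (fourierL2 y),
      quasiMeasurePreserving_expMap.ae (Lp.coeFn_star f)] with ξ h1 h2 h3
    rw [h1, h2, h3]
    simp
    ring
  covariance f x := by
    refine fourierL2.injective (Lp.ext ?_)
    change (fourierL2 (dilateEquiv _ (classicalπ f ((dilateEquiv _).symm x))) : ℝ → ℂ)
      =ᵐ[volume] fourierL2 (classicalπ (compPow N f) x)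
    have hN : (0 : ℝ) < (N : ℝ)⁻¹ :=
      inv_pos.2 (Nat.cast_pos.2 (Nat.pos_of_ne_zero (NeZero.ne N)))
    have hx : fourierL2 ((dilateEquiv hN).symm x) = dilateEquiv hN (fourierL2 x) := by
      have h := fourierL2_dilate hN ((dilateEquiv hN).symm x)
      rw [LinearIsometryEquiv.apply_symm_apply] at h
      rw [h, LinearIsometryEquiv.apply_symm_apply]
    rw [fourierL2_dilate, fourierL2_classicalπ, fourierL2_classicalπ, hx]
    have hD : ∀ y, (dilateEquiv hN).symm y = dilate (inv_pos.2 hN) y := fun _ => rfl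
    have hD' : ∀ y, dilateEquiv hN y = dilate hN y := fun _ => rfl
    rw [hD, hD']
    filter_upwards [coeFn_dilate (inv_pos.2 hN) (mulOp f (dilate hN (fourierL2 x))),
      (quasiMeasurePreserving_mul (inv_pos.2 hN)).ae (coeFn_mulOp f (dilate hN (fourierL2 x))),
      (quasiMeasurePreserving_mul (inv_pos.2 hN)).ae (coeFn_dilate hN (fourierL2 x)),
      coeFn_mulOp (compPow N f) (fourierL2 x),
      quasiMeasurePreserving_expMap.ae
        (coeFn_linftyComp (measurePreserving_pow N).quasiMeasurePreserving f)] with ξ h1 h2 h3 h4 h5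
    have h6 : expMap ((N : ℝ)⁻¹⁻¹ * ξ) = expMap ξ ^ N := by
      simp only [expMap, inv_inv, ← Circle.exp_nsmul]
      congr 1
      simp
      ring
    have h7 : (√((N : ℝ)⁻¹⁻¹) : ℂ) * (√((N : ℝ)⁻¹) : ℂ) = 1 := by
      rw [← Complex.ofReal_mul, ← Real.sqrt_mul (inv_pos.2 hN).le, inv_mul_cancel₀ hN.ne']
      simp
    have h8 : (N : ℝ)⁻¹ * ((N : ℝ)⁻¹⁻¹ * ξ) = ξ := by
      rw [← mul_assoc, mul_inv_cancel₀ hN.ne', one_mul]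
    rw [h1, h2, h3, h4, compPow, h5, h6, h8, Function.comp_apply]
    linear_combination (f (expMap ξ ^ N) * fourierL2 x ξ) * h7

/-- In the classical representation `π(z)` is translation by `1`, `(T g)(x) = g(x - 1)`. -/
theorem classicalRep_π_z (N : ℕ) [NeZero N] (g : L2R) :
    (classicalRep N).π (ContinuousMap.toLp ∞ haar ℂ ⟨fun z : Circle => (z : ℂ), by fun_prop⟩) g =
      Lp.compMeasurePreserving (fun x : ℝ => x - 1) (measurePreserving_sub_right volume 1) g := by
  change fourierL2.symm (mulOp _ (fourierL2 g)) = _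
  rw [LinearIsometryEquiv.symm_apply_eq]
  refine DenseRange.induction_on (p := fun g : L2R =>
      mulOp (ContinuousMap.toLp ∞ haar ℂ ⟨fun z : Circle => (z : ℂ), by fun_prop⟩) (fourierL2 g) =
      fourierL2 (Lp.compMeasurePreservingₗᵢ ℂ (fun x : ℝ => x - 1)
        (measurePreserving_sub_right volume 1) g))
    (SchwartzMap.denseRange_toLpCLM (E := ℝ) (F := ℂ) (μ := volume) (p := 2)
      ENNReal.ofNat_ne_top) g ?_ ?_
  · exact isClosed_eq (by fun_prop) (by fun_prop)
  intro s
  have h1 : Lp.compMeasurePreservingₗᵢ ℂ (fun x : ℝ => x - 1)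
      (measurePreserving_sub_right volume 1) (s.toLp 2) =
      (SchwartzMap.compSubConstCLM ℂ (1 : ℝ) s).toLp 2 := by
    refine Lp.ext ?_
    filter_upwards [Lp.coeFn_compMeasurePreserving (s.toLp 2)
        (measurePreserving_sub_right volume (1 : ℝ)),
      (SchwartzMap.compSubConstCLM ℂ (1 : ℝ) s).coeFn_toLp 2 volume,
      (measurePreserving_sub_right volume (1 : ℝ)).quasiMeasurePreserving.ae
        (s.coeFn_toLp 2 volume)] with x h1 h2 h3
    rw [h2]
    refine Eq.trans h1 ?_
    rw [Function.comp_apply, h3]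
    simp
  change mulOp _ (FourierTransform.fourier (s.toLp 2)) = FourierTransform.fourier
    (Lp.compMeasurePreservingₗᵢ ℂ (fun x : ℝ => x - 1)
      (measurePreserving_sub_right volume 1) (s.toLp 2))
  rw [h1, SchwartzMap.toLp_fourier_eq, SchwartzMap.toLp_fourier_eq]
  refine Lp.ext ?_
  filter_upwards [coeFn_mulOp (ContinuousMap.toLp ∞ haar ℂ ⟨fun z : Circle => (z : ℂ), by fun_prop⟩)
      ((FourierTransform.fourier s).toLp 2),
    (FourierTransform.fourier s).coeFn_toLp 2 volume,
    (FourierTransform.fourier (SchwartzMap.compSubConstCLM ℂ (1 : ℝ) s)).coeFn_toLp 2 volume,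
    quasiMeasurePreserving_expMap.ae (ContinuousMap.coeFn_toLp (p := ∞) (𝕜 := ℂ) haar
      ⟨fun z : Circle => (z : ℂ), by fun_prop⟩)] with x h2 h3 h4 h5
  rw [h2, h3, h4, h5, SchwartzMap.fourier_coe, SchwartzMap.fourier_coe, Real.fourier_eq',
    Real.fourier_eq', ← integral_sub_right_eq_self _ (1 : ℝ), ← integral_const_mul]
  refine integral_congr_ae (Filter.Eventually.of_forall fun v => ?_)
  have h6 : (⟨fun z : Circle => (z : ℂ), by fun_prop⟩ : C(Circle, ℂ)) (expMap x) =
      Complex.exp (((-(2 * Real.pi * x) : ℝ) : ℂ) * Complex.I) := Circle.coe_exp _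
  simp only [h6, SchwartzMap.compSubConstCLM_apply, smul_eq_mul, ← mul_assoc, ← Complex.exp_add]
  congr 2
  simp [inner]
  ring

end

end WaveletRep

namespace WaveletRep

/-! The operators `U^{-k} π(f) U^k` are built from `U` and `π` alone, so every intertwiner respects
them; their asymptotic behaviour is an invariant that tells representations apart.

In a wavelet representation `U` acts on the vectors `π(g) φ` by `g ↦ g(z^N) m₀`, and Haar measure is
invariant under `z ↦ z^N` and under rotations. Hence `⟨U y, π(f) U x⟩ = ⟨y, π(R f) x⟩` for such
vectors (`IsWaveletRep.inner_U_π_U`), and `k` conjugations by `U` replace `f` by `R^k f`. The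
condition `R 1 = 1` makes `R` an averaging operator, and for Lipschitz `f` the iterates `R^k f` are
uniformly Lipschitz. By Arzelà–Ascoli the Cesàro means have cluster points; each is fixed by `R`,
hence constant when `1` is a simple eigenvalue, and equal to `∫ f dν` by invariance
(`tendsto_ruelleMean`). So the means of `U^{-k} π(f) U^k` converge weakly to the scalar `∫ f dν`
(`IsWaveletRep.tendsto_inner_meanOp`). A nonzero intertwiner forces the two scalars to agree for all
Lipschitz `f`, that is, `ν = ν'`.

In the classical representation `U^{-k} π(f) U^k` is, after Fourier transform, multiplication by
`f(e^{-2πiξ/N^k})`, which converges weakly to `f(1)`. If `{1}` is not a cycle, then `‖R f‖ < 1` for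
a function with `f(1) = 1 = ‖f‖` peaking only at `1` (`norm_ruelle_peak_lt`). Comparing the two
sides for an intertwiner `W` gives `‖W‖ ≤ c ‖W‖` with `c < 1`, so `W = 0`. -/

/-! ### Fibres of `z ↦ z ^ N` -/

/-- The rotation `e^{2πi/N}`. -/
noncomputable def rootOfUnity (N : ℕ) : Circle := Circle.exp (2 * Real.pi / N)

theorem isPrimitiveRoot_rootOfUnity (N : ℕ) [NeZero N] :
    IsPrimitiveRoot ((rootOfUnity N : Circle) : ℂ) N := by
  convert Complex.isPrimitiveRoot_exp N (NeZero.ne N) using 1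
  rw [rootOfUnity, Circle.coe_exp]
  congr 1
  push_cast
  ring

theorem rootOfUnity_pow_self (N : ℕ) [NeZero N] : rootOfUnity N ^ N = 1 :=
  Subtype.ext (by simpa using (isPrimitiveRoot_rootOfUnity N).pow_eq_one)

/-- The fibre is one orbit of the rotations by `N`-th roots of unity. Writing the base point as `w ^
N` avoids a choice of root and gives a sum that is visibly continuous and rotation-friendly in `w`.
-/
theorem finsum_fibre (N : ℕ) [NeZero N] {M : Type*} [AddCommMonoid M] (g : Circle → M)
    (w : Circle) :
    ∑ᶠ v ∈ {v : Circle | v ^ N = w ^ N}, g v =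
      ∑ k ∈ Finset.range N, g (rootOfUnity N ^ k * w) := by
  rw [← finsum_mem_coe_finset]
  symm
  refine finsum_mem_eq_of_bijOn (fun k => rootOfUnity N ^ k * w) ⟨?_, ?_, ?_⟩ fun _ _ => rfl
  · intro k _
    simp only [Set.mem_ofPred_eq, mul_pow]
    rw [← pow_mul, mul_comm k, pow_mul, rootOfUnity_pow_self, one_pow, one_mul]
  · intro a ha b hb h
    have h' := congrArg (fun z : Circle => (z : ℂ)) (mul_right_cancel h)
    simp only [Circle.coe_pow] at h'
    exact (isPrimitiveRoot_rootOfUnity N).pow_inj (by simpa using ha) (by simpa using hb) h'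
  · intro v hv
    have hv' : ((v / w : Circle) : ℂ) ^ N = 1 := by
      rw [← Circle.coe_pow, div_pow, show v ^ N = w ^ N from hv]
      simp
    obtain ⟨k, hk, h⟩ := (isPrimitiveRoot_rootOfUnity N).eq_pow_of_pow_eq_one hv'
    refine ⟨k, by simpa using hk, ?_⟩
    have : rootOfUnity N ^ k = v / w := Subtype.ext (by simpa using h)
    simp [this]

theorem exists_pow_eq (N : ℕ) [NeZero N] (z : Circle) : ∃ w : Circle, w ^ N = z :=
  (Circle.isQuotientCoveringMap_npow N).surjective z

theorem ruelle_apply_pow (N : ℕ) [NeZero N] (m f : C(Circle, ℂ)) (w : Circle) :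
    ruelle N m f (w ^ N) = (1 / (N : ℂ)) * ∑ k ∈ Finset.range N,
      (‖m (rootOfUnity N ^ k * w)‖ : ℂ) ^ 2 * f (rootOfUnity N ^ k * w) := by
  rw [← finsum_fibre N (fun v => (‖m v‖ : ℂ) ^ 2 * f v) w]
  rfl

/-- The weights `|m|² / N` form a probability vector on each fibre; this is why the Ruelle operator
is a contraction in the sup norm. -/
theorem sum_sq_norm_eq {N : ℕ} [NeZero N] {m : C(Circle, ℂ)} (hm : ruelle N m 1 = 1)
    (w : Circle) : (1 / (N : ℝ)) * ∑ k ∈ Finset.range N, ‖m (rootOfUnity N ^ k * w)‖ ^ 2 = 1 := by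
  have h := ruelle_apply_pow N m 1 w
  rw [hm] at h
  simp only [ContinuousMap.one_apply, mul_one] at h
  apply Complex.ofReal_injective
  push_cast
  exact h.symm

theorem norm_ruelle_le {N : ℕ} [NeZero N] {m : C(Circle, ℂ)} (hm : ruelle N m 1 = 1)
    (f : C(Circle, ℂ)) : ‖ruelle N m f‖ ≤ ‖f‖ := by
  refine (ContinuousMap.norm_le _ (norm_nonneg f)).2 fun z => ?_
  obtain ⟨w, rfl⟩ := exists_pow_eq N z
  rw [ruelle_apply_pow, norm_mul]
  calc _ ≤ (1 / (N : ℝ)) * ∑ k ∈ Finset.range N, ‖m (rootOfUnity N ^ k * w)‖ ^ 2 * ‖f‖ := by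
        have h1 : ‖(1 / (N : ℂ))‖ = 1 / (N : ℝ) := by simp
        rw [h1]
        gcongr
        refine (norm_sum_le _ _).trans (Finset.sum_le_sum fun k _ => ?_)
        rw [norm_mul, norm_pow, Complex.norm_real, norm_norm]
        gcongr
        exact f.norm_coe_le_norm _
    _ = ‖f‖ := by rw [← Finset.sum_mul, ← mul_assoc, sum_sq_norm_eq hm, one_mul]

theorem continuous_ruelle {N : ℕ} [NeZero N] {m : C(Circle, ℂ)} (hm : ruelle N m 1 = 1) :
    Continuous (ruelle N m) :=
  AddMonoidHomClass.continuous_of_bound (ruelle N m) 1 fun f => by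
    simpa using norm_ruelle_le hm f

theorem norm_ruelle_pow_le {N : ℕ} [NeZero N] {m : C(Circle, ℂ)} (hm : ruelle N m 1 = 1)
    (n : ℕ) (f : C(Circle, ℂ)) : ‖(ruelle N m ^ n) f‖ ≤ ‖f‖ := by
  induction n with
  | zero => simp
  | succ n ih =>
    rw [pow_succ', Module.End.mul_apply]
    exact (norm_ruelle_le hm _).trans ih

/-! ### Lipschitz bounds, uniform along the iterates of the Ruelle operator -/

/-- The lift `t ↦ f (e^{it})` is Lipschitz with constant `L`. -/
def LiftLipschitz (L : ℝ) (f : Circle → ℂ) : Prop :=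
  ∀ s t : ℝ, ‖f (Circle.exp s) - f (Circle.exp t)‖ ≤ L * |s - t|

theorem dist_circle_exp_le (s t : ℝ) : dist (Circle.exp s) (Circle.exp t) ≤ |s - t| := by
  have h : (Circle.exp s : ℂ) - Circle.exp t =
      Circle.exp t * (Complex.exp (Complex.I * ((s - t : ℝ) : ℂ)) - 1) := by
    simp only [Circle.coe_exp, mul_sub, ← Complex.exp_add, mul_one]
    congr 2
    push_cast
    ring
  change dist (Circle.exp s : ℂ) (Circle.exp t : ℂ) ≤ _
  rw [dist_eq_norm, h, norm_mul, Circle.norm_coe, one_mul]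
  exact Real.norm_exp_I_mul_ofReal_sub_one_le

theorem LiftLipschitz.of_lipschitzWith {f : Circle → ℂ} {K : NNReal} (hf : LipschitzWith K f) :
    LiftLipschitz K f := fun s t => by
  rw [← dist_eq_norm]
  exact (hf.dist_le_mul _ _).trans (by gcongr; exact dist_circle_exp_le s t)

/-- An arc is at most `π / 2` times its chord. Iterating on the lift means that this factor is paid
once, not at each application of the Ruelle operator. -/
theorem LiftLipschitz.lipschitzWith {f : Circle → ℂ} {L : NNReal} (hf : LiftLipschitz L f) :
    LipschitzWith (L * ⟨Real.pi / 2, by positivity⟩) f := by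
  refine LipschitzWith.of_dist_le_mul fun z w => ?_
  have hz : Circle.exp (Complex.arg w + Complex.arg (z / w : Circle)) = z := by
    rw [Circle.exp_add, Circle.exp_arg, Circle.exp_arg]
    simp
  have h := hf (Complex.arg w + Complex.arg (z / w : Circle)) (Complex.arg w)
  rw [hz, Circle.exp_arg, add_sub_cancel_left] at h
  rw [dist_eq_norm]
  have h2 := Complex.angle_le_mul_norm_sub (Circle.norm_coe z) (Circle.norm_coe w)
  rw [Complex.angle_eq_abs_arg (Circle.coe_ne_zero z) (Circle.coe_ne_zero w)] at h2
  rw [Circle.coe_div] at h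
  rw [← dist_eq_norm] at h2
  calc _ ≤ (L : ℝ) * |Complex.arg ((z : ℂ) / w)| := h
    _ ≤ L * (Real.pi / 2 * dist (z : ℂ) w) := by gcongr
    _ = _ := (mul_assoc _ _ _).symm

/-- On the lift the inverse branches `t ↦ (t + 2πk) / N` contract by `N`. The variation of `f`
contributes `L / N`, since the weights average to one, and that of `|m|²` contributes at most
`2‖m‖K‖f‖ / N`. The lower bound on `L` makes the latter at most `L / (2N)`, and `N ≥ 2` absorbs the
total into `L`. -/
theorem LiftLipschitz.ruelle {N : ℕ} [NeZero N] (hN : 2 ≤ N) {m f : C(Circle, ℂ)}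
    (hm : ruelle N m 1 = 1) {K L : ℝ} (hK : LiftLipschitz K m) (hf : LiftLipschitz L f)
    (hK0 : 0 ≤ K) (hL : 4 * ‖m‖ * K * ‖f‖ ≤ L) : LiftLipschitz L (ruelle N m f) := by
  intro s t
  have hN0 : (0 : ℝ) < N := by exact_mod_cast Nat.pos_of_ne_zero (NeZero.ne N)
  have hN2 : (2 : ℝ) ≤ N := by exact_mod_cast hN
  have hL0 : 0 ≤ L := le_trans (by positivity) hL
  have hexp : ∀ r : ℝ, Circle.exp r = Circle.exp (r / N) ^ N := fun r => by
    rw [← Circle.exp_nsmul]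
    congr 1
    simp
    field_simp
  have hroot : ∀ (r : ℝ) (k : ℕ), rootOfUnity N ^ k * Circle.exp (r / N) =
      Circle.exp (k * (2 * Real.pi / N) + r / N) := fun r k => by
    rw [rootOfUnity, ← Circle.exp_nsmul, ← Circle.exp_add, nsmul_eq_mul]
  rw [hexp s, hexp t, ruelle_apply_pow, ruelle_apply_pow, ← mul_sub, ← Finset.sum_sub_distrib,
    norm_mul]
  have h1 : ‖(1 / (N : ℂ))‖ = 1 / (N : ℝ) := by simp
  have hs := sum_sq_norm_eq hm (Circle.exp (s / N))
  have hterm : ∀ k ∈ Finset.range N,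
      ‖(‖m (rootOfUnity N ^ k * Circle.exp (s / N))‖ : ℂ) ^ 2 *
          f (rootOfUnity N ^ k * Circle.exp (s / N)) -
        (‖m (rootOfUnity N ^ k * Circle.exp (t / N))‖ : ℂ) ^ 2 *
          f (rootOfUnity N ^ k * Circle.exp (t / N))‖ ≤
      ‖m (rootOfUnity N ^ k * Circle.exp (s / N))‖ ^ 2 * (L * |s - t| / N) +
        2 * ‖m‖ * K * ‖f‖ * |s - t| / N := by
    intro k _
    rw [hroot, hroot]
    set a := (k : ℝ) * (2 * Real.pi / N) + s / N
    set b := (k : ℝ) * (2 * Real.pi / N) + t / N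
    have hab : |a - b| = |s - t| / N := by
      rw [show a - b = (s - t) / N by ring, abs_div, abs_of_pos hN0]
    have e1 := hf a b
    have e2 := hK a b
    rw [hab] at e1 e2
    have e3 : ‖(‖m (Circle.exp a)‖ : ℂ) ^ 2 - (‖m (Circle.exp b)‖ : ℂ) ^ 2‖ ≤
        2 * ‖m‖ * (K * (|s - t| / N)) := by
      rw [sq_sub_sq, norm_mul, ← Complex.ofReal_add, ← Complex.ofReal_sub, Complex.norm_real,
        Complex.norm_real]
      refine mul_le_mul ?_ ((abs_norm_sub_norm_le _ _).trans e2) (norm_nonneg _) (by positivity)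
      rw [Real.norm_of_nonneg (by positivity)]
      linarith [m.norm_coe_le_norm (Circle.exp a), m.norm_coe_le_norm (Circle.exp b)]
    calc _ = ‖(‖m (Circle.exp a)‖ : ℂ) ^ 2 * (f (Circle.exp a) - f (Circle.exp b)) +
          ((‖m (Circle.exp a)‖ : ℂ) ^ 2 - (‖m (Circle.exp b)‖ : ℂ) ^ 2) * f (Circle.exp b)‖ := by
          congr 1; ring
      _ ≤ ‖m (Circle.exp a)‖ ^ 2 * (L * (|s - t| / N)) +
          2 * ‖m‖ * (K * (|s - t| / N)) * ‖f‖ := by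
          refine (norm_add_le _ _).trans ?_
          rw [norm_mul, norm_mul, norm_pow, Complex.norm_real, norm_norm]
          gcongr
          exact f.norm_coe_le_norm _
      _ = _ := by ring
  calc _ ≤ (1 / (N : ℝ)) * ∑ k ∈ Finset.range N,
        (‖m (rootOfUnity N ^ k * Circle.exp (s / N))‖ ^ 2 * (L * |s - t| / N) +
          2 * ‖m‖ * K * ‖f‖ * |s - t| / N) := by
        rw [h1]
        gcongr
        exact (norm_sum_le _ _).trans (Finset.sum_le_sum hterm)
    _ = (L + 2 * ‖m‖ * K * ‖f‖) * |s - t| / N := by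
        rw [Finset.sum_add_distrib, ← Finset.sum_mul, mul_add, ← mul_assoc, hs]
        simp
        field_simp
    _ ≤ L * |s - t| := by
        rw [div_le_iff₀ hN0]
        have : L + 2 * ‖m‖ * K * ‖f‖ ≤ L * N := by nlinarith
        nlinarith [abs_nonneg (s - t)]

theorem exists_liftLipschitz_ruelle_pow {N : ℕ} [NeZero N] (hN : 2 ≤ N) {m f : C(Circle, ℂ)}
    (hm : IsFilter N m) {K : NNReal} (hf : LipschitzWith K f) :
    ∃ L : NNReal, ∀ n, LiftLipschitz L ((ruelle N m ^ n) f) := by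
  obtain ⟨K', hK'⟩ := hm.lipschitz
  -- The first entry serves `n = 0`; the second is the threshold above which the Ruelle operator
  -- preserves the constant. It does not depend on `n` because the norms of the iterates do not
  -- grow.
  refine ⟨max K (4 * ‖m‖₊ * K' * ‖f‖₊), fun n => ?_⟩
  induction n with
  | zero =>
    intro s t
    refine (LiftLipschitz.of_lipschitzWith hf s t).trans ?_
    gcongr
    exact le_max_left _ _
  | succ n ih =>
    rw [pow_succ', Module.End.mul_apply]
    refine LiftLipschitz.ruelle hN hm.ruelle_one (.of_lipschitzWith hK') ih K'.2 ?_
    calc 4 * ‖m‖ * K' * ‖(ruelle N m ^ n) f‖ ≤ 4 * ‖m‖ * K' * ‖f‖ := by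
          gcongr
          exact norm_ruelle_pow_le hm.ruelle_one n f
      _ ≤ _ := by
          rw [NNReal.coe_max]
          exact le_max_right _ _

theorem isCompact_lipschitz_bounded (K : NNReal) (M : ℝ) :
    IsCompact {g : C(Circle, ℂ) | LipschitzWith K g ∧ ‖g‖ ≤ M} := by
  rcases lt_or_ge M 0 with hM | hM
  · convert isCompact_empty
    ext g
    simpa using fun _ => hM.trans_le (norm_nonneg g)
  refine ArzelaAscoli.isCompact_of_equicontinuous _ ?_ ?_
  · have : ContinuousMap.toFun '' {g : C(Circle, ℂ) | LipschitzWith K g ∧ ‖g‖ ≤ M} =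
        {g : Circle → ℂ | LipschitzWith K g} ∩
          Set.univ.pi fun _ => Metric.closedBall (0 : ℂ) M := by
      ext g
      constructor
      · rintro ⟨g, ⟨h1, h2⟩, rfl⟩
        exact ⟨h1, fun z _ => by simpa using (g.norm_coe_le_norm z).trans h2⟩
      · rintro ⟨h1, h2⟩
        exact ⟨⟨g, h1.continuous⟩, ⟨h1, (ContinuousMap.norm_le _ hM).2 fun z => by
          simpa using h2 z trivial⟩, rfl⟩
    rw [this]
    refine (isCompact_univ_pi fun _ => isCompact_closedBall _ _).inter_left ?_
    simp only [lipschitzWith_iff_dist_le_mul, Set.ofPred_forall]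
    exact isClosed_iInter fun x => isClosed_iInter fun y =>
      isClosed_le (by fun_prop) continuous_const
  · exact (LipschitzWith.uniformEquicontinuous _ K fun g => g.2.1).equicontinuous

/-! ### Cesàro means of the iterates -/

/-- The Cesàro means `(1/n) ∑_{k<n} R^k f`. -/
noncomputable def ruelleMean (N : ℕ) [NeZero N] (m f : C(Circle, ℂ)) (n : ℕ) : C(Circle, ℂ) :=
  (n : ℂ)⁻¹ • ∑ k ∈ Finset.range n, (ruelle N m ^ k) f

/-- The difference telescopes to `(R^n f - f) / n`, whose numerator is bounded. Hence every cluster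
point of the means is fixed by `R`. -/
theorem tendsto_ruelle_ruelleMean_sub {N : ℕ} [NeZero N] {m : C(Circle, ℂ)}
    (hm : ruelle N m 1 = 1) (f : C(Circle, ℂ)) :
    Filter.Tendsto (fun n => ruelle N m (ruelleMean N m f n) - ruelleMean N m f n)
      Filter.atTop (nhds 0) := by
  have h1 : ∀ n, ruelle N m (ruelleMean N m f n) - ruelleMean N m f n =
      (n : ℂ)⁻¹ • ((ruelle N m ^ n) f - f) := fun n => by
    rw [ruelleMean, map_smul, map_sum, ← smul_sub, ← Finset.sum_sub_distrib]
    simp only [← Module.End.mul_apply, ← pow_succ']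
    rw [Finset.sum_range_sub (fun k => (ruelle N m ^ k) f)]
    simp
  simp only [h1]
  refine squeeze_zero_norm (a := fun n : ℕ => 2 * ‖f‖ / n) (fun n => ?_)
    (tendsto_const_div_atTop_nhds_zero_nat _)
  rw [norm_smul, norm_inv, Complex.norm_natCast, inv_mul_eq_div]
  gcongr
  linarith [norm_sub_le ((ruelle N m ^ n) f) f, norm_ruelle_pow_le hm n f]

theorem integral_ruelleMean {N : ℕ} [NeZero N] {m : C(Circle, ℂ)} {ν : Measure Circle}
    [IsProbabilityMeasure ν] (hν : IsInvariant N m ν) (f : C(Circle, ℂ)) {n : ℕ} (hn : n ≠ 0) :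
    ∫ z, ruelleMean N m f n z ∂ν = ∫ z, f z ∂ν := by
  have h1 : ∀ k, ∫ z, (ruelle N m ^ k) f z ∂ν = ∫ z, f z ∂ν := fun k => by
    induction k with
    | zero => simp
    | succ k ih => rw [pow_succ', Module.End.mul_apply, hν, ih]
  have h2 : ∀ g : C(Circle, ℂ), Integrable g ν := fun g =>
    g.continuous.integrable_of_hasCompactSupport (HasCompactSupport.of_compactSpace _)
  simp only [ruelleMean, ContinuousMap.smul_apply, ContinuousMap.sum_apply]
  rw [integral_smul, integral_finsetSum _ fun k _ => h2 _]
  simp only [h1, Finset.sum_const, Finset.card_range, nsmul_eq_mul, smul_eq_mul]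
  field_simp

theorem norm_ruelleMean_le {N : ℕ} [NeZero N] {m : C(Circle, ℂ)} (hm : ruelle N m 1 = 1)
    (f : C(Circle, ℂ)) (n : ℕ) : ‖ruelleMean N m f n‖ ≤ ‖f‖ := by
  rcases eq_or_ne n 0 with rfl | hn
  · simp [ruelleMean]
  rw [ruelleMean, norm_smul, norm_inv, Complex.norm_natCast, inv_mul_le_iff₀ (by positivity)]
  refine (norm_sum_le _ _).trans ?_
  refine (Finset.sum_le_sum fun k _ => norm_ruelle_pow_le hm k f).trans ?_
  simp

theorem LiftLipschitz.ruelleMean {N : ℕ} [NeZero N] {m f : C(Circle, ℂ)} {L : NNReal}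
    (h : ∀ n, LiftLipschitz L ((WaveletRep.ruelle N m ^ n) f)) (n : ℕ) :
    LiftLipschitz L (ruelleMean N m f n) := by
  intro s t
  rcases eq_or_ne n 0 with rfl | hn
  · simp only [WaveletRep.ruelleMean, Finset.range_zero, Finset.sum_empty, smul_zero,
      ContinuousMap.zero_apply, sub_zero, norm_zero]
    positivity
  simp only [WaveletRep.ruelleMean, ContinuousMap.smul_apply, ContinuousMap.sum_apply]
  rw [← smul_sub, ← Finset.sum_sub_distrib, norm_smul, norm_inv, Complex.norm_natCast,
    inv_mul_le_iff₀ (by positivity)]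
  refine (norm_sum_le _ _).trans ?_
  refine (Finset.sum_le_sum fun k _ => h k s t).trans ?_
  simp

theorem eq_of_mapClusterPt_of_tendsto {ι X : Type*} [TopologicalSpace X] [T2Space X] {x y : X}
    {l : Filter ι} {u : ι → X} (h : MapClusterPt x l u) (hy : Filter.Tendsto u l (nhds y)) :
    x = y :=
  eq_of_nhds_neBot (Filter.NeBot.mono h (inf_le_inf le_rfl hy))

theorem continuous_integral_continuousMap (ν : Measure Circle) [IsProbabilityMeasure ν] :
    Continuous fun g : C(Circle, ℂ) => ∫ z, g z ∂ν := by
  have h2 : ∀ g : C(Circle, ℂ), Integrable g ν := fun g =>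
    g.continuous.integrable_of_hasCompactSupport (HasCompactSupport.of_compactSpace _)
  refine (LipschitzWith.of_dist_le_mul (K := 1) fun g g' => ?_).continuous
  rw [dist_eq_norm, ← integral_sub (h2 g) (h2 g')]
  refine (norm_integral_le_of_norm_le_const (C := dist g g') (.of_forall fun z => ?_)).trans ?_
  · rw [← dist_eq_norm]
    exact ContinuousMap.dist_apply_le_dist z
  · simp

/-- For a filter with simple eigenvalue `1`, the Cesàro means of a Lipschitz function converge
uniformly to its integral against the invariant measure. -/
theorem tendsto_ruelleMean {N : ℕ} [NeZero N] (hN : 2 ≤ N) {m : C(Circle, ℂ)}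
    (hm : IsFilter N m) (hs : OneIsSimple N m) {ν : Measure Circle} [IsProbabilityMeasure ν]
    (hν : IsInvariant N m ν) {f : C(Circle, ℂ)} {K : NNReal} (hf : LipschitzWith K f) :
    Filter.Tendsto (ruelleMean N m f) Filter.atTop (nhds ((∫ z, f z ∂ν) • (1 : C(Circle, ℂ)))) := by
  obtain ⟨L, hL⟩ := exists_liftLipschitz_ruelle_pow hN hm hf
  -- All the means lie in one compact set, so it suffices to show that each cluster point is the
  -- stated constant.
  refine (isCompact_lipschitz_bounded (L * ⟨Real.pi / 2, by positivity⟩)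
    ‖f‖).tendsto_nhds_of_unique_mapClusterPt (.of_forall fun n =>
      ⟨(LiftLipschitz.ruelleMean hL n).lipschitzWith, norm_ruelleMean_le hm.ruelle_one f n⟩) ?_
  intro g _ hg
  have hfix : ruelle N m g = g := by
    have h1 : MapClusterPt (ruelle N m g - g) Filter.atTop
        (fun n => ruelle N m (ruelleMean N m f n) - ruelleMean N m f n) :=
      hg.continuousAt_comp (f := fun g => ruelle N m g - g)
        ((continuous_ruelle hm.ruelle_one).sub continuous_id).continuousAt
    exact sub_eq_zero.1 (eq_of_mapClusterPt_of_tendsto h1 (tendsto_ruelle_ruelleMean_sub hm.ruelle_one f))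
  have hint : ∫ z, g z ∂ν = ∫ z, f z ∂ν := by
    have h1 : MapClusterPt (∫ z, g z ∂ν) Filter.atTop (fun n => ∫ z, ruelleMean N m f n z ∂ν) :=
      hg.continuousAt_comp (f := fun g : C(Circle, ℂ) => ∫ z, g z ∂ν)
        (continuous_integral_continuousMap ν).continuousAt
    refine eq_of_mapClusterPt_of_tendsto h1 (tendsto_const_nhds.congr' ?_)
    -- The mean with `n = 0` is zero by the convention `0⁻¹ = 0`, so it does not preserve integrals.
    filter_upwards [Filter.eventually_ne_atTop 0] with n hn
    rw [integral_ruelleMean hν f hn]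
  have hmem : ∀ {g : C(Circle, ℂ)}, ruelle N m g = g →
      g ∈ Module.End.eigenspace (ruelle N m) 1 := fun h =>
    Module.End.mem_eigenspace_iff.2 (by rw [h, one_smul])
  -- The constant function `1` spans the one-dimensional eigenspace, so the cluster point is a
  -- constant, which its integral determines.
  obtain ⟨c, hc⟩ := (finrank_eq_one_iff_of_nonzero'
    (⟨1, hmem hm.ruelle_one⟩ : Module.End.eigenspace (ruelle N m) 1)
    fun h => one_ne_zero (congrArg Subtype.val h)).1 hs ⟨g, hmem hfix⟩
  have hc' : c • (1 : C(Circle, ℂ)) = g := congrArg Subtype.val hc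
  rw [← hc', ← hint, ← hc']
  simp

/-! ### Duality between the Ruelle operator and `z ↦ z ^ N` -/

theorem integrable_comp_pow (N : ℕ) [NeZero N] {g : Circle → ℂ} (hg : Integrable g haar) :
    Integrable (fun w : Circle => g (w ^ N)) haar :=
  (measurePreserving_pow N).integrable_comp_of_integrable hg

theorem integral_comp_pow (N : ℕ) [NeZero N] {g : Circle → ℂ} (hg : Integrable g haar) :
    ∫ w : Circle, g (w ^ N) ∂haar = ∫ z, g z ∂haar := by
  have hp := measurePreserving_pow N
  conv_rhs => rw [← hp.map_eq]
  rw [integral_map hp.measurable.aemeasurable]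
  rw [hp.map_eq]
  exact hg.1

theorem integrable_continuousMap_mul (F : C(Circle, ℂ)) {g : Circle → ℂ}
    (hg : Integrable g haar) : Integrable (fun w => F w * g w) haar :=
  hg.bdd_mul F.continuous.aestronglyMeasurable (.of_forall F.norm_coe_le_norm)

/-- The right side is pulled back along `z ↦ z^N`. Each of the `N` fibre terms is then a rotation of
the same integrand, so by rotation invariance they have equal integrals and the factor `1 / N`
cancels. -/
theorem integral_ruelle_mul {N : ℕ} [NeZero N] (m F : C(Circle, ℂ)) {g : Circle → ℂ}
    (hg : Integrable g haar) :
    ∫ w, (‖m w‖ : ℂ) ^ 2 * F w * g (w ^ N) ∂haar = ∫ z, ruelle N m F z * g z ∂haar := by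
  let G : C(Circle, ℂ) := ⟨fun w => (‖m w‖ : ℂ) ^ 2 * F w, by fun_prop⟩
  let J : Circle → ℂ := fun w => G w * g (w ^ N)
  have hJ : Integrable J haar := integrable_continuousMap_mul G (integrable_comp_pow N hg)
  have hroot : ∀ (k : ℕ) (w : Circle), (rootOfUnity N ^ k * w) ^ N = w ^ N := fun k w => by
    rw [mul_pow, ← pow_mul, mul_comm k, pow_mul, rootOfUnity_pow_self, one_pow, one_mul]
  rw [← integral_comp_pow N (integrable_continuousMap_mul (ruelle N m F) hg)]
  have h1 : ∀ w, ruelle N m F (w ^ N) * g (w ^ N) =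
      (1 / (N : ℂ)) * ∑ k ∈ Finset.range N, J (rootOfUnity N ^ k * w) := fun w => by
    simp only [J, hroot, ← Finset.sum_mul, ruelle_apply_pow, mul_assoc]
    rfl
  simp only [h1]
  rw [integral_const_mul, integral_finsetSum _ fun k _ => hJ.comp_mul_left _]
  simp only [integral_mul_left_eq_self J, Finset.sum_const, Finset.card_range, nsmul_eq_mul]
  rw [← mul_assoc, one_div, inv_mul_cancel₀ (Nat.cast_ne_zero.2 (NeZero.ne N)), one_mul]
  rfl

theorem integrable_linfty (g : Linfty) : Integrable g haar :=
  (Lp.memLp g).integrable le_top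

/-- A continuous function as an element of `L^∞`. -/
noncomputable abbrev toLinfty (F : C(Circle, ℂ)) : Linfty := ContinuousMap.toLp ∞ haar ℂ F

theorem coeFn_toLinfty (F : C(Circle, ℂ)) : toLinfty F =ᵐ[haar] F :=
  ContinuousMap.coeFn_toLp haar F

theorem coeFn_linfty_smul (f g : Linfty) : (f • g : Linfty) =ᵐ[haar] fun z => f z * g z :=
  Lp.coeFn_lpSMul (r := ∞) f g

/-! ### Correlations in a wavelet representation -/

section Rep

variable {N : ℕ} [NeZero N] {H : Type*} [NormedAddCommGroup H] [InnerProductSpace ℂ H]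
  [CompleteSpace H] {ρ : ScalingRep N H} {φ : H} {m : C(Circle, ℂ)}

/-- Thus `g ↦ π(g) φ` is isometric for the `L²` norm on `L^∞`, and computations on these vectors
become integrals over the circle. -/
theorem IsWaveletRep.inner_π (h : IsWaveletRep ρ φ m (fun _ => 1)) (f g : Linfty) :
    inner ℂ (ρ.π f φ) (ρ.π g φ) = ∫ z, (starRingEnd ℂ) (f z) * g z ∂haar := by
  rw [← ContinuousLinearMap.adjoint_inner_right, ← ρ.map_star, ← mul_apply_eq_comp,
    ← ρ.map_mul, h.correlation]
  refine integral_congr_ae ?_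
  filter_upwards [coeFn_linfty_smul (star f) g, Lp.coeFn_star f] with z h1 h2
  rw [h1, h2]
  simp

theorem IsWaveletRep.U_π (h : IsWaveletRep ρ φ m (fun _ => 1)) (g : Linfty) :
    ρ.U (ρ.π g φ) = ρ.π (compPow N g • toLinfty m : Linfty) φ := by
  have := ρ.covariance g (ρ.U φ)
  rw [LinearIsometryEquiv.symm_apply_apply] at this
  rw [this, h.scaling, ρ.map_mul]
  rfl

theorem IsWaveletRep.norm_sq_π (h : IsWaveletRep ρ φ m (fun _ => 1)) (g : Linfty) :
    ‖ρ.π g φ‖ ^ 2 = ∫ z, ‖g z‖ ^ 2 ∂haar := by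
  have h1 := h.inner_π g g
  rw [inner_self_eq_norm_sq_to_K] at h1
  apply Complex.ofReal_injective
  rw [← integral_complex_ofReal]
  push_cast
  refine Eq.trans h1 (integral_congr_ae (.of_forall fun z => ?_))
  exact RCLike.conj_mul _

/-- On the vectors `π(g) φ`, the operator `π(F)` is multiplication by `F` in `L²`. The exact factor
`‖F‖` turns sup-norm estimates for the Ruelle operator into estimates of matrix coefficients. -/
theorem IsWaveletRep.norm_π_π_le (h : IsWaveletRep ρ φ m (fun _ => 1)) (F : C(Circle, ℂ))
    (g : Linfty) : ‖ρ.π (toLinfty F) (ρ.π g φ)‖ ≤ ‖F‖ * ‖ρ.π g φ‖ := by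
  rw [← mul_apply_eq_comp, ← ρ.map_mul]
  refine le_of_sq_le_sq ?_ (by positivity)
  rw [mul_pow, h.norm_sq_π, h.norm_sq_π, ← integral_const_mul]
  have hint : ∀ f : Linfty, Integrable (fun z => ‖f z‖ ^ 2) haar := fun f =>
    ((Lp.memLp f).mono_exponent le_top).norm.integrable_sq
  refine integral_mono_ae (hint _) ((hint g).const_mul _) ?_
  filter_upwards [coeFn_linfty_smul (toLinfty F) g, coeFn_toLinfty F] with z h1 h2
  rw [h1, h2, norm_mul, mul_pow]
  gcongr
  exact F.norm_coe_le_norm z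

/-- The vectors `π(g) φ`. -/
noncomputable def coreSpace (ρ : ScalingRep N H) (φ : H) : Submodule ℂ H :=
  LinearMap.range ((ContinuousLinearMap.apply ℂ H φ).toLinearMap ∘ₗ ρ.π)

theorem IsWaveletRep.U_mem_coreSpace (h : IsWaveletRep ρ φ m (fun _ => 1)) {x : H}
    (hx : x ∈ coreSpace ρ φ) : ρ.U x ∈ coreSpace ρ φ := by
  obtain ⟨g, rfl⟩ := hx
  exact ⟨_, (h.U_π g).symm⟩

/-- Two factors `g ↦ g(z^N) m` produce the weight `|m|²` and a function of `z^N`; the duality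
`integral_ruelle_mul` then moves the Ruelle operator onto `F`. -/
theorem IsWaveletRep.inner_U_π_U (h : IsWaveletRep ρ φ m (fun _ => 1)) {x y : H}
    (hx : x ∈ coreSpace ρ φ) (hy : y ∈ coreSpace ρ φ) (F : C(Circle, ℂ)) :
    inner ℂ (ρ.U y) (ρ.π (toLinfty F) (ρ.U x)) =
      inner ℂ y (ρ.π (toLinfty (ruelle N m F)) x) := by
  obtain ⟨g, rfl⟩ := hx
  obtain ⟨f, rfl⟩ := hy
  change inner ℂ (ρ.U (ρ.π f φ)) (ρ.π (toLinfty F) (ρ.U (ρ.π g φ))) =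
    inner ℂ (ρ.π f φ) (ρ.π (toLinfty (ruelle N m F)) (ρ.π g φ))
  rw [h.U_π, h.U_π, ← mul_apply_eq_comp, ← mul_apply_eq_comp,
    ← ρ.map_mul, ← ρ.map_mul, h.inner_π, h.inner_π]
  have hp := (measurePreserving_pow N).quasiMeasurePreserving
  have hc := fun f : Linfty => coeFn_linftyComp hp f
  calc _ = ∫ w, (‖m w‖ : ℂ) ^ 2 * F w * (star f • g : Linfty) (w ^ N) ∂haar := by
        refine integral_congr_ae ?_
        filter_upwards [coeFn_linfty_smul (compPow N f) (toLinfty m),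
          coeFn_linfty_smul (compPow N g) (toLinfty m),
          coeFn_linfty_smul (toLinfty F) (compPow N g • toLinfty m : Linfty),
          coeFn_toLinfty m, coeFn_toLinfty F, hc f, hc g,
          hp.ae (coeFn_linfty_smul (star f) g), hp.ae (Lp.coeFn_star f)]
          with w h1 h2 h3 h4 h5 h6 h7 h8 h9
        rw [h1, h3, h2, h4, h5, compPow, compPow, h6, h7, h8, h9, ← Complex.conj_mul']
        simp only [Function.comp_apply, map_mul, Pi.star_apply, RCLike.star_def]
        ring
    _ = ∫ z, ruelle N m F z * (star f • g : Linfty) z ∂haar :=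
        integral_ruelle_mul m F (integrable_linfty _)
    _ = _ := by
        refine integral_congr_ae ?_
        filter_upwards [coeFn_linfty_smul (toLinfty (ruelle N m F)) g,
          coeFn_toLinfty (ruelle N m F), coeFn_linfty_smul (star f) g, Lp.coeFn_star f]
          with w h1 h2 h3 h4
        rw [h1, h2, h3, h4]
        simp only [Pi.star_apply, RCLike.star_def]
        ring

theorem IsWaveletRep.pow_mem_coreSpace (h : IsWaveletRep ρ φ m (fun _ => 1)) {x : H}
    (hx : x ∈ coreSpace ρ φ) (k : ℕ) : (ρ.U ^ k) x ∈ coreSpace ρ φ := by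
  induction k with
  | zero => exact hx
  | succ k ih =>
    rw [pow_succ']
    exact h.U_mem_coreSpace ih

theorem IsWaveletRep.inner_pow_π_pow (h : IsWaveletRep ρ φ m (fun _ => 1)) {x y : H}
    (hx : x ∈ coreSpace ρ φ) (hy : y ∈ coreSpace ρ φ) (F : C(Circle, ℂ)) (k : ℕ) :
    inner ℂ ((ρ.U ^ k) y) (ρ.π (toLinfty F) ((ρ.U ^ k) x)) =
      inner ℂ y (ρ.π (toLinfty ((ruelle N m ^ k) F)) x) := by
  induction k generalizing F with
  | zero => rfl
  | succ k ih =>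
    rw [pow_succ' ρ.U, pow_succ (ruelle N m), Module.End.mul_apply, ← ih]
    exact h.inner_U_π_U (h.pow_mem_coreSpace hx k) (h.pow_mem_coreSpace hy k) F

/-- Every vector of a dense set is moved into `{π(g) φ}` by some power of `U`. -/
theorem IsWaveletRep.dense_setOf_pow_mem (h : IsWaveletRep ρ φ m (fun _ => 1)) :
    Dense {x : H | ∃ k : ℕ, (ρ.U ^ k) x ∈ coreSpace ρ φ} := by
  refine h.cyclic.mono fun x hx => ?_
  have hadd : ∀ {x : H} {k : ℕ} (l : ℕ), (ρ.U ^ k) x ∈ coreSpace ρ φ →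
      (ρ.U ^ (l + k)) x ∈ coreSpace ρ φ := fun l hk => by
    rw [pow_add]
    exact h.pow_mem_coreSpace hk l
  induction hx using Submodule.span_induction with
  | mem x hx =>
    obtain ⟨n, f, rfl⟩ := hx
    have hf : ρ.π f φ ∈ coreSpace ρ φ := ⟨f, rfl⟩
    rcases le_total 0 n with hn | hn
    · lift n to ℕ using hn
      refine ⟨n, ?_⟩
      have : (ρ.U ^ n) ((ρ.U ^ (-(n : ℤ))) (ρ.π f φ)) = ρ.π f φ := by
        rw [zpow_neg, zpow_natCast]
        exact (ρ.U ^ n).apply_symm_apply _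
      rw [this]
      exact hf
    · obtain ⟨k, hk⟩ := Int.eq_ofNat_of_zero_le (neg_nonneg.2 hn)
      refine ⟨0, ?_⟩
      rw [hk, zpow_natCast]
      exact h.pow_mem_coreSpace hf k
  | zero => exact ⟨0, by simp⟩
  | add x y _ _ hx hy =>
    obtain ⟨k, hk⟩ := hx
    obtain ⟨l, hl⟩ := hy
    refine ⟨l + k, ?_⟩
    rw [map_add]
    exact add_mem (hadd l hk) (by rw [add_comm]; exact hadd k hl)
  | smul c x _ hx =>
    obtain ⟨k, hk⟩ := hx
    exact ⟨k, by rw [map_smul]; exact Submodule.smul_mem _ _ hk⟩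

/-! ### The operators `U^{-k} π(f) U^k` -/

/-- The operator `U^{-k} π(f) U^k`. -/
noncomputable def conjOp (ρ : ScalingRep N H) (f : Linfty) (k : ℕ) : H →L[ℂ] H :=
  ((ρ.U ^ k).symm.toContinuousLinearEquiv : H →L[ℂ] H) ∘L ρ.π f ∘L
    ((ρ.U ^ k).toContinuousLinearEquiv : H →L[ℂ] H)

theorem conjOp_apply (f : Linfty) (k : ℕ) (x : H) :
    conjOp ρ f k x = (ρ.U ^ k).symm (ρ.π f ((ρ.U ^ k) x)) := rfl

theorem inner_conjOp (f : Linfty) (k : ℕ) (x y : H) :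
    inner ℂ y (conjOp ρ f k x) = inner ℂ ((ρ.U ^ k) y) (ρ.π f ((ρ.U ^ k) x)) := by
  rw [← (ρ.U ^ k).inner_map_map, conjOp_apply, LinearIsometryEquiv.apply_symm_apply]

theorem norm_conjOp_le (f : Linfty) (k : ℕ) : ‖conjOp ρ f k‖ ≤ ‖ρ.π f‖ :=
  ContinuousLinearMap.opNorm_le_bound _ (norm_nonneg _) fun x => by
    rw [conjOp_apply, LinearIsometryEquiv.norm_map]
    simpa using (ρ.π f).le_opNorm ((ρ.U ^ k) x)

theorem inner_conjOp_succ (f : Linfty) (k : ℕ) (x y : H) :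
    inner ℂ y (conjOp ρ f (k + 1) x) = inner ℂ (ρ.U y) (conjOp ρ f k (ρ.U x)) := by
  rw [inner_conjOp, inner_conjOp, pow_succ]
  rfl

theorem conjOp_intertwine {H' : Type*} [NormedAddCommGroup H'] [InnerProductSpace ℂ H']
    [CompleteSpace H'] {ρ' : ScalingRep N H'} {W : H →L[ℂ] H'}
    (hU : ∀ x, W (ρ.U x) = ρ'.U (W x)) (hπ : ∀ (f : Linfty) (x : H), W (ρ.π f x) = ρ'.π f (W x))
    (f : Linfty) (k : ℕ) (x : H) : W (conjOp ρ f k x) = conjOp ρ' f k (W x) := by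
  have hpow : ∀ (k : ℕ) (x : H), W ((ρ.U ^ k) x) = (ρ'.U ^ k) (W x) := fun k => by
    induction k with
    | zero => exact fun _ => rfl
    | succ k ih =>
      intro x
      rw [pow_succ', pow_succ']
      exact (hU _).trans (congrArg ρ'.U (ih x))
  apply (ρ'.U ^ k).injective
  rw [← hpow, conjOp_apply, conjOp_apply, LinearIsometryEquiv.apply_symm_apply,
    LinearIsometryEquiv.apply_symm_apply, hπ, hpow]

end Rep

/-! ### Weak limits of the means of `U^{-k} π(f) U^k` -/

/-- Asymptotic bounds for a bounded sequence of operators extend from a dense set. -/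
theorem eventually_norm_inner_le_of_dense {H : Type*} [NormedAddCommGroup H]
    [InnerProductSpace ℂ H] {S : ℕ → H →L[ℂ] H} {C c : ℝ}
    (hS : ∀ n, ‖S n‖ ≤ C) {D : Set H} (hD : Dense D)
    (h : ∀ x ∈ D, ∀ y ∈ D, ∀ ε > 0, ∀ᶠ n in Filter.atTop,
      ‖(inner ℂ y (S n x) : ℂ)‖ ≤ c * ‖y‖ * ‖x‖ + ε)
    (x y : H) {ε : ℝ} (hε : 0 < ε) :
    ∀ᶠ n in Filter.atTop, ‖(inner ℂ y (S n x) : ℂ)‖ ≤ c * ‖y‖ * ‖x‖ + ε := by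
  -- The bound at the approximants plus the cost of replacing `(x, y)` by them. It is continuous and
  -- equals `c‖y‖‖x‖` at `(x, y)`, so it stays within `ε / 2` of that value nearby.
  let B : H × H → ℝ := fun p =>
    c * ‖p.2‖ * ‖p.1‖ + ‖y - p.2‖ * (C * ‖x‖) + ‖p.2‖ * (C * ‖x - p.1‖)
  have hB : Continuous B := by fun_prop
  obtain ⟨⟨x', y'⟩, ⟨hx', hy'⟩, hlt⟩ := (hD.prod hD).exists_mem_open
    (isOpen_lt hB (continuous_const (y := c * ‖y‖ * ‖x‖ + ε / 2))) ⟨(x, y), by simp [B, hε]⟩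
  filter_upwards [h x' hx' y' hy' (ε / 2) (half_pos hε)] with n hn
  have hle : ∀ z, ‖S n z‖ ≤ C * ‖z‖ := fun z => (S n).le_of_opNorm_le (hS n) z
  have e : (inner ℂ y (S n x) : ℂ) = inner ℂ y' (S n x') + inner ℂ (y - y') (S n x) +
      inner ℂ y' (S n (x - x')) := by
    rw [inner_sub_left, map_sub, inner_sub_right]
    ring
  have e1 := (norm_inner_le_norm (𝕜 := ℂ) (y - y') (S n x)).trans
    (mul_le_mul_of_nonneg_left (hle x) (norm_nonneg _))
  have e2 := (norm_inner_le_norm (𝕜 := ℂ) y' (S n (x - x'))).trans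
    (mul_le_mul_of_nonneg_left (hle _) (norm_nonneg _))
  have hlt' : B (x', y') < c * ‖y‖ * ‖x‖ + ε / 2 := hlt
  simp only [B] at hlt'
  rw [e]
  linarith [norm_add₃_le (a := (inner ℂ y' (S n x') : ℂ)) (b := inner ℂ (y - y') (S n x))
    (c := inner ℂ y' (S n (x - x')))]

section Mean

variable {N : ℕ} [NeZero N] {H : Type*} [NormedAddCommGroup H] [InnerProductSpace ℂ H]
  [CompleteSpace H] {ρ : ScalingRep N H} {φ : H} {m : C(Circle, ℂ)}

theorem IsWaveletRep.norm_inner_π_le (h : IsWaveletRep ρ φ m (fun _ => 1)) (F : C(Circle, ℂ))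
    {x : H} (hx : x ∈ coreSpace ρ φ) (y : H) :
    ‖(inner ℂ y (ρ.π (toLinfty F) x) : ℂ)‖ ≤ ‖F‖ * ‖y‖ * ‖x‖ := by
  obtain ⟨g, rfl⟩ := hx
  refine (norm_inner_le_norm _ _).trans ?_
  rw [mul_comm ‖F‖, mul_assoc]
  gcongr
  exact h.norm_π_π_le F g

/-- The mean `(1/n) ∑_{k<n} U^{-k} π(f) U^k`. -/
noncomputable def meanOp (ρ : ScalingRep N H) (f : Linfty) (n : ℕ) : H →L[ℂ] H :=
  (n : ℂ)⁻¹ • ∑ k ∈ Finset.range n, conjOp ρ f k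

theorem norm_meanOp_le (f : Linfty) (n : ℕ) : ‖meanOp ρ f n‖ ≤ ‖ρ.π f‖ := by
  rcases eq_or_ne n 0 with rfl | hn
  · simp [meanOp]
  rw [meanOp, norm_smul, norm_inv, Complex.norm_natCast, inv_mul_le_iff₀ (by positivity)]
  refine (norm_sum_le _ _).trans ?_
  refine (Finset.sum_le_sum fun k _ => norm_conjOp_le f k).trans ?_
  simp

theorem inner_meanOp (f : Linfty) (n : ℕ) (x y : H) :
    inner ℂ y (meanOp ρ f n x) =
      (n : ℂ)⁻¹ * ∑ k ∈ Finset.range n, (inner ℂ y (conjOp ρ f k x) : ℂ) := by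
  rw [meanOp, smul_apply, inner_smul_right, sum_apply, inner_sum]

/-- Conjugation by `U` shifts the index `k` by one, so only two boundary terms survive, divided by
`n`. Limits for `U x, U y` thereby pass back to `x, y`. -/
theorem tendsto_inner_meanOp_sub (f : Linfty) (x y : H) :
    Filter.Tendsto (fun n => (inner ℂ y (meanOp ρ f n x) : ℂ) -
      inner ℂ (ρ.U y) (meanOp ρ f n (ρ.U x))) Filter.atTop (nhds 0) := by
  refine squeeze_zero_norm (a := fun n : ℕ => 2 * (‖y‖ * (‖ρ.π f‖ * ‖x‖)) / n) (fun n => ?_)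
    (tendsto_const_div_atTop_nhds_zero_nat _)
  have hb : ∀ k, ‖(inner ℂ y (conjOp ρ f k x) : ℂ)‖ ≤ ‖y‖ * (‖ρ.π f‖ * ‖x‖) := fun k =>
    (norm_inner_le_norm _ _).trans (by
      gcongr
      exact (conjOp ρ f k).le_of_opNorm_le (norm_conjOp_le f k) x)
  simp only [inner_meanOp, ← inner_conjOp_succ]
  rw [← mul_sub, ← Finset.sum_sub_distrib,
    Finset.sum_range_sub' (fun k => (inner ℂ y (conjOp ρ f k x) : ℂ)), norm_mul, norm_inv,
    Complex.norm_natCast, inv_mul_eq_div]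
  gcongr
  refine (norm_sub_le _ _).trans ?_
  linarith [hb 0, hb n]

/-- For a filter with simple eigenvalue `1`, the means of `U^{-k} π(f) U^k` converge weakly to
the scalar `∫ f dν`. -/
theorem IsWaveletRep.tendsto_inner_meanOp (h : IsWaveletRep ρ φ m (fun _ => 1)) (hN : 2 ≤ N)
    (hm : IsFilter N m) (hs : OneIsSimple N m) {ν : Measure Circle} [IsProbabilityMeasure ν]
    (hν : IsInvariant N m ν) {f : C(Circle, ℂ)} {K : NNReal} (hf : LipschitzWith K f) (x y : H) :
    Filter.Tendsto (fun n => (inner ℂ y (meanOp ρ (toLinfty f) n x) : ℂ)) Filter.atTop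
      (nhds ((∫ z, f z ∂ν) * inner ℂ y x)) := by
  set c := ∫ z, f z ∂ν
  have hone : ρ.π (toLinfty 1) = 1 := ρ.map_one
  have hcore : ∀ x ∈ coreSpace ρ φ, ∀ y ∈ coreSpace ρ φ,
      Filter.Tendsto (fun n => (inner ℂ y (meanOp ρ (toLinfty f) n x) : ℂ)) Filter.atTop
        (nhds (c * inner ℂ y x)) := by
    intro x hx y hy
    -- On the core the means of operators become `π` of the Cesàro means of functions, so uniform
    -- convergence of the latter is enough.
    have h1 : ∀ n, (inner ℂ y (meanOp ρ (toLinfty f) n x) : ℂ) - c * inner ℂ y x =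
        inner ℂ y (ρ.π (toLinfty (ruelleMean N m f n - c • (1 : C(Circle, ℂ)))) x) := fun n => by
      have h2 : ρ.π (toLinfty (ruelleMean N m f n - c • (1 : C(Circle, ℂ)))) =
          (n : ℂ)⁻¹ • ∑ k ∈ Finset.range n, ρ.π (toLinfty ((ruelle N m ^ k) f)) -
            c • (1 : H →L[ℂ] H) := by
        rw [← hone]
        simp only [toLinfty, ruelleMean, map_sub, map_smul, map_sum]
      rw [h2, inner_meanOp, sub_apply, smul_apply, smul_apply, inner_sub_right,
        inner_smul_right, inner_smul_right, sum_apply, inner_sum]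
      simp only [inner_conjOp, h.inner_pow_π_pow hx hy]
      rfl
    refine tendsto_sub_nhds_zero_iff.1 (squeeze_zero_norm (fun n => ?_) (?_ : Filter.Tendsto
      (fun n => ‖ruelleMean N m f n - c • (1 : C(Circle, ℂ))‖ * ‖y‖ * ‖x‖) _ _))
    · rw [h1]
      exact h.norm_inner_π_le _ hx y
    · have := (tendsto_iff_norm_sub_tendsto_zero.1
        (tendsto_ruelleMean hN hm hs hν hf)).mul_const (‖y‖ * ‖x‖)
      simpa [mul_assoc] using this
  have hpow : ∀ (k : ℕ) (x y : H), (ρ.U ^ k) x ∈ coreSpace ρ φ → (ρ.U ^ k) y ∈ coreSpace ρ φ →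
      Filter.Tendsto (fun n => (inner ℂ y (meanOp ρ (toLinfty f) n x) : ℂ)) Filter.atTop
        (nhds (c * inner ℂ y x)) := by
    intro k
    induction k with
    | zero => exact fun x y hx hy => hcore x hx y hy
    | succ k ih =>
      intro x y hx hy
      rw [pow_succ] at hx hy
      have := (tendsto_inner_meanOp_sub (ρ := ρ) (toLinfty f) x y).add (ih (ρ.U x) (ρ.U y) hx hy)
      simpa using this
  have hS : ∀ n, ‖meanOp ρ (toLinfty f) n - c • (1 : H →L[ℂ] H)‖ ≤
      ‖ρ.π (toLinfty f)‖ + ‖c • (1 : H →L[ℂ] H)‖ := fun n =>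
    (norm_sub_le _ _).trans (by gcongr; exact norm_meanOp_le _ n)
  have hexp : ∀ n (x y : H), (inner ℂ y ((meanOp ρ (toLinfty f) n - c • (1 : H →L[ℂ] H)) x) : ℂ) =
      inner ℂ y (meanOp ρ (toLinfty f) n x) - c * inner ℂ y x := fun n x y => by
    rw [sub_apply, smul_apply, inner_sub_right, inner_smul_right]
    rfl
  rw [← tendsto_sub_nhds_zero_iff, Metric.tendsto_nhds]
  intro ε hε
  -- With constant `0` the asymptotic bound says that the matrix coefficients of the difference tend
  -- to zero.
  have := eventually_norm_inner_le_of_dense (c := 0) hS h.dense_setOf_pow_mem ?_ x y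
    (half_pos hε)
  · filter_upwards [this] with n hn
    rw [hexp] at hn
    rw [dist_zero_right]
    linarith
  · rintro x ⟨k, hk⟩ y ⟨l, hl⟩ ε hε
    have h1 : (ρ.U ^ (l + k)) x ∈ coreSpace ρ φ := by
      rw [pow_add]
      exact h.pow_mem_coreSpace hk l
    have h2 : (ρ.U ^ (l + k)) y ∈ coreSpace ρ φ := by
      rw [add_comm, pow_add]
      exact h.pow_mem_coreSpace hl k
    have h3 := tendsto_sub_nhds_zero_iff.2 (hpow _ x y h1 h2)
    filter_upwards [Metric.tendsto_nhds.1 h3 ε hε] with n hn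
    rw [hexp, zero_mul, zero_mul, zero_add]
    rw [dist_zero_right] at hn
    exact hn.le

theorem meanOp_intertwine {H' : Type*} [NormedAddCommGroup H'] [InnerProductSpace ℂ H']
    [CompleteSpace H'] {ρ' : ScalingRep N H'} {W : H →L[ℂ] H'}
    (hU : ∀ x, W (ρ.U x) = ρ'.U (W x)) (hπ : ∀ (f : Linfty) (x : H), W (ρ.π f x) = ρ'.π f (W x))
    (f : Linfty) (n : ℕ) (x : H) : W (meanOp ρ f n x) = meanOp ρ' f n (W x) := by
  simp only [meanOp, smul_apply, sum_apply, map_smul, map_sum,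
    conjOp_intertwine hU hπ]

end Mean

/-! ### Disjointness from different invariant measures -/

theorem eq_of_forall_lipschitz_integral_eq {ν ν' : Measure Circle} [IsProbabilityMeasure ν]
    [IsProbabilityMeasure ν'] (h : ∀ (f : C(Circle, ℂ)) (K : NNReal), LipschitzWith K f →
      ∫ z, f z ∂ν = ∫ z, f z ∂ν') : ν = ν' := by
  let P : ProbabilityMeasure Circle := ⟨ν, ‹_›⟩
  let P' : ProbabilityMeasure Circle := ⟨ν', ‹_›⟩
  -- Weak convergence can be tested on bounded Lipschitz functions; applied to a constant sequence
  -- in a Hausdorff space, this gives equality.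
  have key : Filter.Tendsto (fun _ : ℕ => P) Filter.atTop (nhds P') := by
    rw [tendsto_iff_forall_lipschitz_integral_tendsto]
    rintro f - ⟨L, hL⟩
    have h1 := h ⟨fun z => (f z : ℂ), Complex.continuous_ofReal.comp hL.continuous⟩ L
      (LipschitzWith.of_dist_le_mul fun x y => by
        change dist (f x : ℂ) (f y : ℂ) ≤ _
        rw [Complex.dist_eq, ← Complex.ofReal_sub, Complex.norm_real, ← dist_eq_norm]
        exact hL.dist_le_mul x y)
    simp only [ContinuousMap.coe_mk, integral_complex_ofReal] at h1
    have h2 : ∫ z, f z ∂ν = ∫ z, f z ∂ν' := Complex.ofReal_injective h1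
    simpa only [P, P', ProbabilityMeasure.coe_mk, h2] using tendsto_const_nhds
  exact congrArg (fun μ : ProbabilityMeasure Circle => (μ : Measure Circle))
    (tendsto_nhds_unique (a := P) tendsto_const_nhds key)

/-- The wavelet representations of two filters with simple eigenvalue `1` and different invariant
measures are disjoint. -/
theorem disjointReps_of_ne {N : ℕ} [NeZero N] (hN : 2 ≤ N) {m m' : C(Circle, ℂ)}
    (hm : IsFilter N m) (hm' : IsFilter N m') (hs : OneIsSimple N m) (hs' : OneIsSimple N m')
    {ν ν' : Measure Circle} [IsProbabilityMeasure ν] [IsProbabilityMeasure ν']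
    (hν : IsInvariant N m ν) (hν' : IsInvariant N m' ν')
    {H : Type u} [NormedAddCommGroup H] [InnerProductSpace ℂ H] [CompleteSpace H]
    {H' : Type v} [NormedAddCommGroup H'] [InnerProductSpace ℂ H'] [CompleteSpace H']
    {ρ : ScalingRep N H} {ρ' : ScalingRep N H'} {φ : H} {φ' : H'}
    (h : IsWaveletRep ρ φ m (fun _ => 1)) (h' : IsWaveletRep ρ' φ' m' (fun _ => 1))
    (hne : ν ≠ ν') : DisjointReps ρ ρ' := by
  intro W hU hπ
  by_contra hW
  obtain ⟨x, hx⟩ : ∃ x, W x ≠ 0 := by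
    by_contra! h0
    exact hW (ContinuousLinearMap.ext h0)
  refine hne (eq_of_forall_lipschitz_integral_eq fun f K hf => ?_)
  -- Pairing with `W* W x` and intertwining turns the first sequence into the second, so `‖W x‖²` is
  -- multiplied by both integrals in the limit.
  have h1 := h.tendsto_inner_meanOp hN hm hs hν hf x (ContinuousLinearMap.adjoint W (W x))
  have h2 := h'.tendsto_inner_meanOp hN hm' hs' hν' hf (W x) (W x)
  simp only [ContinuousLinearMap.adjoint_inner_left, meanOp_intertwine hU hπ] at h1
  exact mul_right_cancel₀ (inner_self_ne_zero.2 hx) (tendsto_nhds_unique h1 h2)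

/-! ### The classical representation -/

theorem coeFn_dilateEquiv_symm_pow {a : ℝ} (ha : 0 < a) (k : ℕ) (g : L2R) :
    ((dilateEquiv ha).symm ^ k) g =ᵐ[volume]
      fun ξ => (√a⁻¹ : ℂ) ^ k * g (a⁻¹ ^ k * ξ) := by
  induction k generalizing g with
  | zero => exact .of_forall fun ξ => by simp
  | succ k ih =>
    rw [pow_succ]
    filter_upwards [ih ((dilateEquiv ha).symm g),
      (quasiMeasurePreserving_mul (pow_pos (inv_pos.2 ha) k)).ae
        (coeFn_dilate (inv_pos.2 ha) g)] with ξ h1 h2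
    refine h1.trans ?_
    have h3 : ((dilateEquiv ha).symm g : ℝ → ℂ) (a⁻¹ ^ k * ξ) =
      (√a⁻¹ : ℂ) * g (a⁻¹ * (a⁻¹ ^ k * ξ)) := h2
    rw [h3, ← mul_assoc, ← pow_succ, ← mul_assoc, ← pow_succ']

theorem fourierL2_dilateEquiv_pow {a : ℝ} (ha : 0 < a) (k : ℕ) (g : L2R) :
    fourierL2 ((dilateEquiv ha ^ k) g) = ((dilateEquiv ha).symm ^ k) (fourierL2 g) := by
  induction k with
  | zero => rfl
  | succ k ih =>
    rw [pow_succ', pow_succ']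
    exact (fourierL2_dilate ha _).trans (congrArg (dilateEquiv ha).symm ih)

/-- The Fourier transform turns the dilation into its inverse; the substitution `ξ ↦ N^k ξ` then
undoes it on the two vectors and leaves it only in the argument of `f`. -/
theorem inner_conjOp_classicalRep {N : ℕ} [NeZero N] (f : C(Circle, ℂ)) (k : ℕ) (x y : L2R) :
    inner ℂ y (conjOp (classicalRep N) (toLinfty f) k x) =
      ∫ ξ, f (expMap (((N : ℝ) ^ k)⁻¹ * ξ)) * inner ℂ (fourierL2 y ξ) (fourierL2 x ξ) := by
  have hN : (0 : ℝ) < N := Nat.cast_pos.2 (Nat.pos_of_ne_zero (NeZero.ne N))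
  have hN' : (0 : ℝ) < (N : ℝ)⁻¹ := inv_pos.2 hN
  rw [inner_conjOp]
  change inner ℂ ((dilateEquiv hN' ^ k) y) (classicalπ (toLinfty f) ((dilateEquiv hN' ^ k) x)) = _
  rw [← fourierL2.inner_map_map, fourierL2_classicalπ, fourierL2_dilateEquiv_pow,
    fourierL2_dilateEquiv_pow, L2.inner_def]
  let J : ℝ → ℂ := fun ξ =>
    f (expMap (((N : ℝ) ^ k)⁻¹ * ξ)) * inner ℂ (fourierL2 y ξ) (fourierL2 x ξ)
  have hJ := Measure.integral_comp_mul_left J ((N : ℝ) ^ k)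
  have hNk : (0 : ℝ) < (N : ℝ) ^ k := pow_pos hN k
  calc _ = ∫ ξ, ((N : ℝ) ^ k : ℝ) • J ((N : ℝ) ^ k * ξ) := by
        refine integral_congr_ae ?_
        filter_upwards [coeFn_mulOp (toLinfty f) (((dilateEquiv hN').symm ^ k) (fourierL2 x)),
          coeFn_dilateEquiv_symm_pow hN' k (fourierL2 x),
          coeFn_dilateEquiv_symm_pow hN' k (fourierL2 y),
          quasiMeasurePreserving_expMap.ae (coeFn_toLinfty f)] with ξ h1 h2 h3 h4
        have h5 : (√(N : ℝ) : ℂ) * (√(N : ℝ) : ℂ) = (N : ℂ) := by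
          rw [← Complex.ofReal_mul, Real.mul_self_sqrt hN.le, Complex.ofReal_natCast]
        rw [h1, h2, h3, h4]
        simp only [J, inv_inv, RCLike.inner_apply, map_mul, map_pow, Complex.conj_ofReal,
          Complex.real_smul, inv_mul_cancel_left₀ hNk.ne']
        push_cast
        rw [← h5, mul_pow]
        ring
    _ = ∫ ξ, J ξ := by
        rw [integral_smul, hJ, smul_smul, abs_of_pos (inv_pos.2 hNk), mul_inv_cancel₀ hNk.ne',
          one_smul]

/-- The multipliers are bounded by `‖f‖` and tend pointwise to `f 1`, so dominated convergence
applies. The point mass at `1` plays the role of the invariant measure here. -/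
theorem tendsto_inner_conjOp_classicalRep {N : ℕ} [NeZero N] (hN : 2 ≤ N) (f : C(Circle, ℂ))
    (x y : L2R) :
    Filter.Tendsto (fun k => (inner ℂ y (conjOp (classicalRep N) (toLinfty f) k x) : ℂ))
      Filter.atTop (nhds (f 1 * inner ℂ y x)) := by
  have hint : Integrable (fun ξ => (inner ℂ (fourierL2 y ξ) (fourierL2 x ξ) : ℂ)) volume :=
    L2.integrable_inner _ _
  have h0 : f 1 * inner ℂ y x = ∫ ξ, f 1 * inner ℂ (fourierL2 y ξ) (fourierL2 x ξ) := by
    rw [integral_const_mul, ← fourierL2.inner_map_map, L2.inner_def]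
  simp only [inner_conjOp_classicalRep, h0]
  refine tendsto_integral_of_dominated_convergence
    (fun ξ => ‖f‖ * ‖(inner ℂ (fourierL2 y ξ) (fourierL2 x ξ) : ℂ)‖) (fun k => ?_)
    (hint.norm.const_mul _) (fun k => .of_forall fun ξ => ?_) (.of_forall fun ξ => ?_)
  · exact (f.continuous.comp (continuous_expMap.comp
      (continuous_const_mul _))).aestronglyMeasurable.mul hint.1
  · rw [norm_mul]
    gcongr
    exact f.norm_coe_le_norm _
  · refine Filter.Tendsto.mul_const _ ?_
    have h1 : Filter.Tendsto (fun k : ℕ => ((N : ℝ) ^ k)⁻¹ * ξ) Filter.atTop (nhds 0) := by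
      have h2 : Filter.Tendsto (fun k : ℕ => (N : ℝ) ^ k) Filter.atTop Filter.atTop :=
        tendsto_pow_atTop_atTop_of_one_lt (by exact_mod_cast hN)
      simpa using h2.inv_tendsto_atTop.mul_const ξ
    have h3 : expMap 0 = 1 := by simp [expMap]
    have h4 := ((f.continuous.comp continuous_expMap).tendsto 0).comp h1
    simpa [Function.comp_def, h3] using h4

/-! ### Filters for which the fixed point `1` is not a cycle -/

/-- The function `z ↦ (1 + z) / 2`, whose modulus peaks exactly at `1`. -/
noncomputable def peak : C(Circle, ℂ) := ⟨fun z => (1 + z) / 2, by fun_prop⟩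

theorem peak_one : peak 1 = 1 := by
  simp [peak]

theorem norm_peak_le (z : Circle) : ‖peak z‖ ≤ 1 := by
  change ‖(1 + z : ℂ) / 2‖ ≤ 1
  rw [norm_div, Complex.norm_ofNat, div_le_one two_pos]
  refine (norm_add_le _ _).trans ?_
  rw [norm_one, Circle.norm_coe]
  norm_num

theorem norm_peak_lt {z : Circle} (hz : z ≠ 1) : ‖peak z‖ < 1 := by
  refine lt_of_le_of_ne (norm_peak_le z) fun h => hz ?_
  change ‖(1 + z : ℂ) / 2‖ = 1 at h
  rw [norm_div, Complex.norm_ofNat, div_eq_one_iff_eq two_ne_zero] at h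
  -- For unit vectors, `‖1 + z‖ = 2` leaves nothing for `‖1 - z‖`.
  have h1 := parallelogram_law_with_norm ℂ (1 : ℂ) z
  rw [h, norm_one, Circle.norm_coe] at h1
  have h2 : ‖(1 : ℂ) - z‖ = 0 := by nlinarith
  exact Subtype.ext (sub_eq_zero.1 (norm_eq_zero.1 h2)).symm

/-- A weighted average of values of modulus at most `1` has modulus `1` only if all the weight sits
where the modulus is `1`, here at the point `1`. That would force `|m(1)|² = N`. Compactness turns
the pointwise strict inequality into one for the norm. -/
theorem norm_ruelle_peak_lt {N : ℕ} [NeZero N] {m : C(Circle, ℂ)} (hm : ruelle N m 1 = 1)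
    (h1 : ‖m 1‖ ^ 2 ≠ N) : ‖ruelle N m peak‖ < 1 := by
  have hN : (0 : ℝ) < N := Nat.cast_pos.2 (Nat.pos_of_ne_zero (NeZero.ne N))
  refine (ContinuousMap.norm_lt_iff _ one_pos).2 fun z => ?_
  obtain ⟨w, rfl⟩ := exists_pow_eq N z
  have hsum := sum_sq_norm_eq hm w
  rw [one_div, inv_mul_eq_one₀ hN.ne'] at hsum
  -- Otherwise every point of positive weight is `1`. The points of the fibre are distinct, so a
  -- single term carries the whole sum `N`.
  have hlt : ∃ k ∈ Finset.range N, m (rootOfUnity N ^ k * w) ≠ 0 ∧ rootOfUnity N ^ k * w ≠ 1 := by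
    by_contra! hcon
    obtain ⟨k, hk, hk0⟩ : ∃ k ∈ Finset.range N, ‖m (rootOfUnity N ^ k * w)‖ ^ 2 ≠ 0 :=
      Finset.exists_ne_zero_of_sum_ne_zero (hsum ▸ hN.ne')
    have hk1 := hcon k hk fun h => hk0 (by simp [h])
    rw [Finset.sum_eq_single_of_mem k hk, hk1] at hsum
    · exact h1 hsum.symm
    · intro j hj hjk
      by_contra hj0
      have hj1 := hcon j hj fun h => hj0 (by simp [h])
      have h' := congrArg (fun z : Circle => (z : ℂ)) (mul_right_cancel (hj1.trans hk1.symm))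
      simp only [Circle.coe_pow] at h'
      exact hjk ((isPrimitiveRoot_rootOfUnity N).pow_inj (by simpa using hj) (by simpa using hk) h')
  obtain ⟨k, hk, hk0, hk1⟩ := hlt
  rw [ruelle_apply_pow, norm_mul, norm_div, norm_one, Complex.norm_natCast, one_div,
    inv_mul_lt_iff₀ hN, mul_one]
  refine (norm_sum_le _ _).trans_lt ?_
  conv_rhs => rw [hsum]
  simp only [norm_mul, norm_pow, Complex.norm_real, norm_norm]
  refine Finset.sum_lt_sum (fun j _ => ?_) ⟨k, hk, ?_⟩
  · exact mul_le_of_le_one_right (by positivity) (norm_peak_le _)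
  · exact mul_lt_of_lt_one_right (by positivity) (norm_peak_lt hk1)

/-- One application of the Ruelle operator already yields the factor `‖R f‖`, and further iterates
do not increase it. -/
theorem IsWaveletRep.eventually_norm_inner_conjOp_le {N : ℕ} [NeZero N] {H : Type*}
    [NormedAddCommGroup H] [InnerProductSpace ℂ H] [CompleteSpace H] {ρ : ScalingRep N H} {φ : H}
    {m : C(Circle, ℂ)} (h : IsWaveletRep ρ φ m (fun _ => 1)) (hm : ruelle N m 1 = 1)
    (f : C(Circle, ℂ)) (x y : H) {ε : ℝ} (hε : 0 < ε) :
    ∀ᶠ n in Filter.atTop, ‖(inner ℂ y (conjOp ρ (toLinfty f) n x) : ℂ)‖ ≤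
      ‖ruelle N m f‖ * ‖y‖ * ‖x‖ + ε := by
  refine eventually_norm_inner_le_of_dense (norm_conjOp_le _) h.dense_setOf_pow_mem ?_ x y hε
  rintro x ⟨k, hk⟩ y ⟨l, hl⟩ ε hε
  have h1 : (ρ.U ^ (l + k)) x ∈ coreSpace ρ φ := by
    rw [pow_add]
    exact h.pow_mem_coreSpace hk l
  have h2 : (ρ.U ^ (l + k)) y ∈ coreSpace ρ φ := by
    rw [add_comm, pow_add]
    exact h.pow_mem_coreSpace hl k
  -- Of the `n` powers of `U`, `l + k` bring both vectors into the core, and the remaining `j + 1 ≥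
  -- 1` act as iterates of the Ruelle operator on `f`.
  filter_upwards [Filter.eventually_ge_atTop (l + k + 1)] with n hn
  obtain ⟨j, rfl⟩ := Nat.exists_eq_add_of_le hn
  have hsplit : ρ.U ^ (l + k + 1 + j) = ρ.U ^ (j + 1) * ρ.U ^ (l + k) := by
    rw [← pow_add]
    congr 1
    ring
  rw [inner_conjOp, hsplit]
  refine le_add_of_le_of_nonneg ?_ hε.le
  refine (congrArg norm (h.inner_pow_π_pow h1 h2 f (j + 1))).trans_le ?_
  refine (h.norm_inner_π_le _ h1 _).trans ?_
  rw [LinearIsometryEquiv.norm_map, LinearIsometryEquiv.norm_map]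
  gcongr
  rw [pow_succ, Module.End.mul_apply]
  exact norm_ruelle_pow_le hm j _

/-- If `|m₀(1)|² ≠ N`, then the wavelet representation of `m₀` is disjoint from the classical
one. -/
theorem disjointReps_classicalRep {N : ℕ} [NeZero N] (hN : 2 ≤ N) {m : C(Circle, ℂ)}
    (hm : ruelle N m 1 = 1) (h1 : ‖m 1‖ ^ 2 ≠ N) {H : Type u} [NormedAddCommGroup H]
    [InnerProductSpace ℂ H] [CompleteSpace H] {ρ : ScalingRep N H} {φ : H}
    (h : IsWaveletRep ρ φ m (fun _ => 1)) : DisjointReps ρ (classicalRep N) := by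
  intro W hU hπ
  set c := ‖ruelle N m peak‖
  have hc : c < 1 := norm_ruelle_peak_lt hm h1
  -- The same matrix coefficients tend to `‖W x‖²` on the classical side, as the peak function is
  -- `1` at `1`, and are asymptotically bounded with the factor `c` on the wavelet side.
  have hinner : ∀ x, ‖W x‖ * ‖W x‖ ≤ c * ‖ContinuousLinearMap.adjoint W (W x)‖ * ‖x‖ := by
    intro x
    refine le_of_forall_pos_le_add fun ε hε => ?_
    have h2 := tendsto_inner_conjOp_classicalRep hN peak (W x) (W x)
    rw [peak_one, one_mul] at h2
    simp only [← conjOp_intertwine hU hπ, ← ContinuousLinearMap.adjoint_inner_left W] at h2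
    have h3 := le_of_tendsto h2.norm (h.eventually_norm_inner_conjOp_le hm peak x
      (ContinuousLinearMap.adjoint W (W x)) hε)
    rwa [ContinuousLinearMap.adjoint_inner_left, inner_self_eq_norm_sq_to_K, norm_pow,
      RCLike.norm_ofReal, abs_norm, sq] at h3
  have hle : ‖W‖ ≤ c * ‖W‖ := by
    refine W.opNorm_le_bound (by positivity) fun x => ?_
    rcases eq_or_lt_of_le (norm_nonneg (W x)) with h0 | h0
    · rw [← h0]
      positivity
    refine le_of_mul_le_mul_right ?_ h0
    refine (hinner x).trans ?_
    have h4 := (ContinuousLinearMap.adjoint W).le_opNorm (W x)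
    rw [LinearIsometryEquiv.norm_map] at h4
    calc c * ‖ContinuousLinearMap.adjoint W (W x)‖ * ‖x‖ ≤ c * (‖W‖ * ‖W x‖) * ‖x‖ := by gcongr
      _ = _ := by ring
  refine norm_eq_zero.1 (le_antisymm ?_ (norm_nonneg W))
  nlinarith

end WaveletRep

theorem mainTheorem8 (N : ℕ) [NeZero N] (hN : 2 ≤ N) :
    -- two filters with different invariant measures
    (∀ (m₀ m₀' : C(Circle, ℂ)),
      WaveletRep.IsFilter N m₀ → WaveletRep.IsFilter N m₀' →
      WaveletRep.OneIsSimple N m₀ → WaveletRep.OneIsSimple N m₀' →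
      ∀ (ν ν' : MeasureTheory.Measure Circle)
        [MeasureTheory.IsProbabilityMeasure ν] [MeasureTheory.IsProbabilityMeasure ν'],
      WaveletRep.IsInvariant N m₀ ν → WaveletRep.IsInvariant N m₀' ν' →
      ∀ (H : Type u) [NormedAddCommGroup H] [InnerProductSpace ℂ H] [CompleteSpace H]
        (H' : Type v) [NormedAddCommGroup H'] [InnerProductSpace ℂ H'] [CompleteSpace H']
        (ρ : WaveletRep.ScalingRep N H) (ρ' : WaveletRep.ScalingRep N H') (φ : H) (φ' : H'),
      WaveletRep.IsWaveletRep ρ φ m₀ (fun _ => 1) →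
      WaveletRep.IsWaveletRep ρ' φ' m₀' (fun _ => 1) →
      ν ≠ ν' → WaveletRep.DisjointReps ρ ρ') ∧
    -- a filter without cycles, and the classical representation
    (∀ (m₀ : C(Circle, ℂ)), WaveletRep.IsFilter N m₀ →
      (¬ ∃ (p : ℕ) (z : Fin (p + 1) → Circle), WaveletRep.IsCycle N m₀ z) →
      ∀ (H : Type u) [NormedAddCommGroup H] [InnerProductSpace ℂ H] [CompleteSpace H]
        (ρ : WaveletRep.ScalingRep N H) (φ : H),
      WaveletRep.IsWaveletRep ρ φ m₀ (fun _ => 1) →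
      WaveletRep.DisjointReps ρ (WaveletRep.classicalRep N)) := by
  refine ⟨?_, ?_⟩
  · intro m₀ m₀' hm hm' hs hs' ν ν' _ _ hν hν' H _ _ _ H' _ _ _ ρ ρ' φ φ' h h' hne
    exact WaveletRep.disjointReps_of_ne hN hm hm' hs hs' hν hν' h h' hne
  · intro m₀ hm hcyc H _ _ _ ρ φ h
    refine WaveletRep.disjointReps_classicalRep hN hm.ruelle_one (fun h1 => hcyc ?_) h
    -- Index `p = 0` means a cycle of length one: the fixed point `1` of `z ↦ z^N`.
    exact ⟨0, fun _ => 1, fun _ => ⟨one_pow N, h1⟩⟩
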